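/- Let $W$ be a compact metric space, $S$ a countable set and $E=W^S$ with the product topology (a compact metrizable space). For every finite $\Lambda\subseteq S$ and $\eta\in E$ let $c_\Lambda(\eta,d\zeta)$ be a finite Borel measure on $W^\Lambda$, depending weakly continuously on $\eta$. Put $c_\Lambda=\sup_\eta c_\Lambda(\eta,W^\Lambda)$ and $$c_\Lambda(u)=\sup\{\|c_\Lambda(\eta,\cdot)-c_\Lambda(\hat\eta,\cdot)\|_{TV} : \eta_y=\hat\eta_y \text{ for all } y\neq u\},$$ and assume $$\sup_{x\in S}\sum_{\Lambda\ni x}c_\Lambda<\infty ,\qquad \sup_{x\in S}\sum_{\Lambda\ni x}\sum_{u\ne x}c_\Lambda(u)<\infty .$$ For $f\in C(E)$ let $\Delta_f(x)=\sup\{|f(\eta)-f(\zeta)| : \eta_y=\zeta_y \text{ for all } y\ne x\}$ and $|||f|||=\sum_{x\in S}\Delta_f(x)$; let $D=\{f\in C(E): |||f|||<\infty\}$ with the norm $\|f\|_D=|||f|||+\|f\|$, where $\|\cdot\|$ is the sup norm, and let $\tau_D$ be the norm topology. For $f\in D$ let $$Af(\eta)=\sum_\Lambda\int c_\Lambda(\eta,d\zeta)\,[f(\eta^\zeta)-f(\eta)],$$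 where $\eta^\zeta$ equals $\zeta$ on $\Lambda$ and $\eta$ off $\Lambda$. Then $(D,\|\cdot\|_D)$ is a separable Banach space. The series defining $Af$ converges to a continuous function for every $f\in D$, the operator $(A,D)$ in $C(E)$ is closable, and its closure (again denoted by $A$, with domain $\mathcal D(A)$) is the generator of a strongly continuous positive semigroup $S(t)$ on $C(E)$ with $S(t)1=1$. For this semigroup put $V(t)f=\log S(t)e^f$ and $Hf=e^{-f}Ae^f$. The following two sets of conditions hold. Condition 1. $D$ is dense in $C(E)$ and is a core for $A$: $D\subseteq\mathcal D(A)$, and for every $f\in\mathcal D(A)$ there are $f_n\in D$ with $f_n\to f$ and $Af_n\to Af$ in sup norm. If $f,g\in D$ then $fg\in D$. If $f\in D$ and $\phi$ is a real function that is smooth on an open neighbourhood of the range of $f$, then $\phi\circ f\in D$. Condition 2. (a) $(D,\tau_D)$ is a separable barrelled locally convex Hausdorff space. (b) $\tau_D$ is finer than the sup norm topology on $D$. (c) The maps $f\mapsto e^f-1$, $D\to D$, and $(f,g)\mapsto fg$, $D\times D\to D$, are well defined and $\tau_D$-continuous. (d) $S(t)D\subseteq D$ and $V(t)D\subseteq D$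 for all $t\ge0$; the maps $S(t),V(t):D\to D$ are $\tau_D$-continuous for every $t$, and $t\mapsto S(t)f$ and $t\mapsto V(t)f$ are $\tau_D$-continuous on $[0,\infty)$ for every $f\in D$. (e) $A:(D,\tau_D)\to(C(E),\|\cdot\|)$ is continuous. (f) $e^f\in\mathcal D(A)$ for every $f\in D$, and there is a barrel (a convex, balanced, absorbing and closed set) $\mathcal N\subseteq D$ with $\sup_{f\in\mathcal N}\|Hf\|\le1$ and $\sup_{f\in c\mathcal N}\|Hf\|<\infty$ for every $c>0$. -/

import Mathlib

open Filter Topology MeasureTheory Set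
open scoped NNReal ENNReal ContDiff Pointwise

noncomputable section

/-! ### Markov semigroups on `C(E)`, their generators and the conditions on a core -/

/-- A strongly continuous positive conservative (hence contractive) semigroup on `C(E)`,
where `E` is compact. -/
structure MarkovSemigroup (E : Type*) [TopologicalSpace E] [CompactSpace E] where
  op : ℝ≥0 → C(E, ℝ) →L[ℝ] C(E, ℝ)
  op_zero : op 0 = ContinuousLinearMap.id ℝ C(E, ℝ)
  op_add : ∀ s t, op (s + t) = (op s).comp (op t)
  op_nonneg : ∀ t f, 0 ≤ f → 0 ≤ op t f
  op_one : ∀ t, op t 1 = 1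
  continuous_op : ∀ f, Continuous fun t => op t f

namespace MarkovSemigroup

variable {E : Type*} [TopologicalSpace E] [CompactSpace E]

/-- `g` is the derivative at time `0` (from the right, in sup norm) of `t ↦ T(t) f`. -/
def HasGenerator (T : MarkovSemigroup E) (f g : C(E, ℝ)) : Prop :=
  Tendsto (fun t : ℝ≥0 => (t : ℝ)⁻¹ • (T.op t f - f)) (𝓝[>] 0) (𝓝 g)

theorem HasGenerator.add {T : MarkovSemigroup E} {f g f' g' : C(E, ℝ)}
    (h : T.HasGenerator f g) (h' : T.HasGenerator f' g') : T.HasGenerator (f + f') (g + g') := by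
  refine (Tendsto.add h h').congr fun t => ?_
  rw [map_add, ← smul_add]
  congr 1
  abel

theorem HasGenerator.smul {T : MarkovSemigroup E} {f g : C(E, ℝ)} (a : ℝ)
    (h : T.HasGenerator f g) : T.HasGenerator (a • f) (a • g) := by
  refine (Tendsto.const_smul h a).congr fun t => ?_
  rw [map_smul, ← smul_sub, smul_comm]

theorem HasGenerator.unique {T : MarkovSemigroup E} {f g g' : C(E, ℝ)}
    (h : T.HasGenerator f g) (h' : T.HasGenerator f g') : g = g' :=
  tendsto_nhds_unique h h'

/-- The infinitesimal generator, with its maximal domain. -/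
def generator (T : MarkovSemigroup E) : C(E, ℝ) →ₗ.[ℝ] C(E, ℝ) where
  domain :=
    { carrier := {f | ∃ g, T.HasGenerator f g}
      zero_mem' := ⟨0, by simp [HasGenerator]⟩
      add_mem' := fun ⟨g, hg⟩ ⟨g', hg'⟩ => ⟨g + g', hg.add hg'⟩
      smul_mem' := fun a _ ⟨g, hg⟩ => ⟨a • g, hg.smul a⟩ }
  toFun :=
    { toFun := fun f => Classical.choose f.2
      map_add' := fun f f' =>
        (Classical.choose_spec (f + f').2).unique
          ((Classical.choose_spec f.2).add (Classical.choose_spec f'.2))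
      map_smul' := fun a f =>
        (Classical.choose_spec (a • f).2).unique ((Classical.choose_spec f.2).smul a) }

end MarkovSemigroup

/-- The continuous function `e^f`. -/
def expFun {E : Type*} [TopologicalSpace E] (f : C(E, ℝ)) : C(E, ℝ) :=
  ⟨fun x => Real.exp (f x), Real.continuous_exp.comp f.continuous⟩

/-- `H f = e^{-f} A e^f`, for `f` such that `e^f` is in the domain of `A`. -/
def hamiltonian {E : Type*} [TopologicalSpace E] [CompactSpace E]
    (A : C(E, ℝ) →ₗ.[ℝ] C(E, ℝ)) (f : C(E, ℝ)) (hf : expFun f ∈ A.domain) : C(E, ℝ) :=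
  expFun (-f) * A ⟨expFun f, hf⟩

/-- A barrel: a convex, balanced, absorbing and closed set. -/
structure IsBarrel {X : Type*} [AddCommGroup X] [Module ℝ X] [TopologicalSpace X]
    (B : Set X) : Prop where
  convex : Convex ℝ B
  balanced : Balanced ℝ B
  absorbent : Absorbent ℝ B
  isClosed : IsClosed B

/-- The first set of conditions, for compact `E`. The core `D` is the range of the injective
linear map `ι : X → C(E)`: a dense subalgebra of `C(E)`, a core for the generator, stable under
composition with functions that are smooth (on a neighbourhood of the range). -/
structure AlgebraCoreCondition {E X : Type*} [TopologicalSpace E] [CompactSpace E]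
    [AddCommGroup X] [Module ℝ X] (T : MarkovSemigroup E) (ι : X →ₗ[ℝ] C(E, ℝ)) : Prop where
  injective : Function.Injective ι
  le_domain : ∀ f : X, ι f ∈ T.generator.domain
  core : ∀ f : T.generator.domain, ∃ u : ℕ → X,
    Tendsto (fun n => ι (u n)) atTop (𝓝 (f : C(E, ℝ))) ∧
    Tendsto (fun n => T.generator ⟨ι (u n), le_domain (u n)⟩) atTop (𝓝 (T.generator f))
  dense : DenseRange ι
  mul_mem : ∀ f g : X, ∃ h : X, ι h = ι f * ι g
  smooth_comp_mem : ∀ (f : X) (φ : ℝ → ℝ) (U : Set ℝ), IsOpen U → range (ι f) ⊆ U →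
    ContDiffOn ℝ ∞ φ U → ∃ g : X, ∀ x, ι g x = φ (ι f x)

/-- The second set of conditions, for the topology of `X` carried over to the core
`D = range ι`. Here `V(t) f = log T(t) e^f` and `H f = e^{-f} A e^f`. -/
structure TopologicalCoreCondition {E X : Type*} [TopologicalSpace E] [CompactSpace E]
    [AddCommGroup X] [Module ℝ X] [TopologicalSpace X]
    (T : MarkovSemigroup E) (ι : X →ₗ[ℝ] C(E, ℝ)) : Prop
    extends AlgebraCoreCondition T ι where
  isTopologicalAddGroup : IsTopologicalAddGroup X
  continuousSMul : ContinuousSMul ℝ X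
  locallyConvex : LocallyConvexSpace ℝ X
  hausdorff : T2Space X
  separable : TopologicalSpace.SeparableSpace X
  barrelled : ∀ B : Set X, IsBarrel B → B ∈ 𝓝 (0 : X)
  finer : Continuous ι
  exp_sub_one : ∃ F : X → X, (∀ f, ι (F f) = expFun (ι f) - 1) ∧ Continuous F
  mul : ∃ F : X × X → X, (∀ p, ι (F p) = ι p.1 * ι p.2) ∧ Continuous F
  semigroup : ∃ F : ℝ≥0 → X → X, (∀ t f, ι (F t f) = T.op t (ι f)) ∧
    (∀ t, Continuous (F t)) ∧ ∀ f, Continuous fun t => F t f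
  log_semigroup : ∃ F : ℝ≥0 → X → X,
    (∀ t f x, ι (F t f) x = Real.log (T.op t (expFun (ι f)) x)) ∧
    (∀ t, Continuous (F t)) ∧ ∀ f, Continuous fun t => F t f
  continuous_generator : Continuous fun f : X => T.generator ⟨ι f, le_domain f⟩
  exp_mem_domain : ∀ f : X, expFun (ι f) ∈ T.generator.domain
  hamiltonian_bound : ∃ N : Set X, IsBarrel N ∧
    (∀ f ∈ N, ‖hamiltonian T.generator (ι f) (exp_mem_domain f)‖ ≤ 1) ∧
    ∀ c : ℝ, 0 < c → ∃ M : ℝ, ∀ f ∈ c • N,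
      ‖hamiltonian T.generator (ι f) (exp_mem_domain f)‖ ≤ M

/-! ### Interacting particle systems -/

namespace IPS

section TestFunctions

variable {W S : Type*} [TopologicalSpace W] [CompactSpace W]

/-- `Δ_f(x)`, the variation of `f` at the site `x`. -/
def variation (f : C(S → W, ℝ)) (x : S) : ℝ≥0∞ :=
  ⨆ (η : S → W) (ζ : S → W) (_ : ∀ y, y ≠ x → η y = ζ y), ENNReal.ofReal |f η - f ζ|

/-- `|||f||| = ∑ₓ Δ_f(x)`. -/
def tripleNorm (f : C(S → W, ℝ)) : ℝ≥0∞ := ∑' x, variation f x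

theorem variation_zero (x : S) : variation (0 : C(S → W, ℝ)) x = 0 := by
  simp [variation]

theorem variation_add_le (f g : C(S → W, ℝ)) (x : S) :
    variation (f + g) x ≤ variation f x + variation g x := by
  refine iSup_le fun η => iSup_le fun ζ => iSup_le fun h => ?_
  calc ENNReal.ofReal |(f + g) η - (f + g) ζ|
      ≤ ENNReal.ofReal (|f η - f ζ| + |g η - g ζ|) := by
        refine ENNReal.ofReal_le_ofReal ?_
        have : (f + g) η - (f + g) ζ = (f η - f ζ) + (g η - g ζ) := by
          simp only [ContinuousMap.add_apply]; ring
        rw [this]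
        exact abs_add_le _ _
    _ = ENNReal.ofReal |f η - f ζ| + ENNReal.ofReal |g η - g ζ| :=
        ENNReal.ofReal_add (abs_nonneg _) (abs_nonneg _)
    _ ≤ variation f x + variation g x :=
        add_le_add
          (le_iSup_of_le η (le_iSup_of_le ζ
            (le_iSup (fun _ : ∀ y, y ≠ x → η y = ζ y => ENNReal.ofReal |f η - f ζ|) h)))
          (le_iSup_of_le η (le_iSup_of_le ζ
            (le_iSup (fun _ : ∀ y, y ≠ x → η y = ζ y => ENNReal.ofReal |g η - g ζ|) h)))

theorem variation_smul (a : ℝ) (f : C(S → W, ℝ)) (x : S) :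
    variation (a • f) x = ENNReal.ofReal |a| * variation f x := by
  simp only [variation, ENNReal.mul_iSup]
  refine iSup_congr fun η => iSup_congr fun ζ => iSup_congr fun _ => ?_
  rw [← ENNReal.ofReal_mul (abs_nonneg a), ← abs_mul]
  simp [mul_sub]

theorem tripleNorm_zero : tripleNorm (0 : C(S → W, ℝ)) = 0 := by
  simp [tripleNorm, variation_zero]

theorem tripleNorm_add_le (f g : C(S → W, ℝ)) :
    tripleNorm (f + g) ≤ tripleNorm f + tripleNorm g := by
  rw [tripleNorm, tripleNorm, tripleNorm, ← ENNReal.tsum_add]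
  exact ENNReal.tsum_le_tsum fun x => variation_add_le f g x

theorem tripleNorm_smul (a : ℝ) (f : C(S → W, ℝ)) :
    tripleNorm (a • f) = ENNReal.ofReal |a| * tripleNorm f := by
  simp only [tripleNorm, variation_smul, ENNReal.tsum_mul_left]

variable (W S) in
/-- The space of test functions `D = {f ∈ C(E) : |||f||| < ∞}`, where `E = W^S`. -/
def testFunctions : Submodule ℝ C(S → W, ℝ) where
  carrier := {f | tripleNorm f < ⊤}
  zero_mem' := by simp [tripleNorm_zero]
  add_mem' := fun hf hg =>
    (tripleNorm_add_le _ _).trans_lt (ENNReal.add_lt_top.2 ⟨hf, hg⟩)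
  smul_mem' := fun a f hf => by
    change tripleNorm (a • f) < ⊤
    rw [tripleNorm_smul]
    exact ENNReal.mul_lt_top ENNReal.ofReal_lt_top hf

variable (W S) in
/-- The space `D` again, as a type that will carry the norm `|||·||| + ‖·‖` (and not the sup
norm inherited from `C(E)`). -/
def TestSpace : Type _ := testFunctions W S

instance : AddCommGroup (TestSpace W S) := inferInstanceAs (AddCommGroup (testFunctions W S))

instance : Module ℝ (TestSpace W S) := inferInstanceAs (Module ℝ (testFunctions W S))

variable (W S) in
/-- The inclusion of `D` in `C(E)`. -/
def TestSpace.incl : TestSpace W S →ₗ[ℝ] C(S → W, ℝ) := (testFunctions W S).subtype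

instance : Norm (TestSpace W S) :=
  ⟨fun f => (tripleNorm (TestSpace.incl W S f)).toReal + ‖TestSpace.incl W S f‖⟩

theorem TestSpace.normedSpaceCore : NormedSpace.Core ℝ (TestSpace W S) where
  norm_nonneg f := add_nonneg ENNReal.toReal_nonneg (norm_nonneg _)
  norm_smul a f := by
    change (tripleNorm (TestSpace.incl W S (a • f))).toReal + ‖TestSpace.incl W S (a • f)‖ =
      ‖a‖ * ((tripleNorm (TestSpace.incl W S f)).toReal + ‖TestSpace.incl W S f‖)
    rw [map_smul, tripleNorm_smul, norm_smul, ENNReal.toReal_mul,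
      ENNReal.toReal_ofReal (abs_nonneg a), Real.norm_eq_abs, mul_add]
  norm_triangle f g := by
    change (tripleNorm (TestSpace.incl W S (f + g))).toReal + ‖TestSpace.incl W S (f + g)‖ ≤
      ((tripleNorm (TestSpace.incl W S f)).toReal + ‖TestSpace.incl W S f‖) +
      ((tripleNorm (TestSpace.incl W S g)).toReal + ‖TestSpace.incl W S g‖)
    have hf : tripleNorm (TestSpace.incl W S f) ≠ ⊤ := f.2.ne
    have hg : tripleNorm (TestSpace.incl W S g) ≠ ⊤ := g.2.ne
    have h1 := ENNReal.toReal_mono (ENNReal.add_ne_top.2 ⟨hf, hg⟩)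
      (tripleNorm_add_le (TestSpace.incl W S f) (TestSpace.incl W S g))
    rw [ENNReal.toReal_add hf hg] at h1
    have h2 := norm_add_le (TestSpace.incl W S f) (TestSpace.incl W S g)
    rw [map_add]
    linarith
  norm_eq_zero_iff f := by
    change (tripleNorm (TestSpace.incl W S f)).toReal + ‖TestSpace.incl W S f‖ = 0 ↔ f = 0
    constructor
    · intro h
      have h1 : 0 ≤ (tripleNorm (TestSpace.incl W S f)).toReal := ENNReal.toReal_nonneg
      have h2 : ‖TestSpace.incl W S f‖ = 0 := by
        linarith [norm_nonneg (TestSpace.incl W S f)]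
      exact Subtype.ext (norm_eq_zero.1 h2)
    · rintro rfl
      simp [tripleNorm_zero]

/-- `‖f‖_D = |||f||| + ‖f‖`. -/
instance : NormedAddCommGroup (TestSpace W S) :=
  NormedAddCommGroup.ofCore TestSpace.normedSpaceCore

instance : NormedSpace ℝ (TestSpace W S) := NormedSpace.ofCore TestSpace.normedSpaceCore

end TestFunctions

section Rates

variable {W S : Type*} [MetricSpace W] [CompactSpace W] [MeasurableSpace W] [BorelSpace W]

variable (W S) in
/-- The transition rates `c_Λ(η, dζ)`: for every finite set of sites `Λ` and every configuration
`η` a finite measure on `W^Λ`, depending on `η` in a weakly continuous way. -/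
abbrev Rates : Type _ := (Λ : Finset S) → C(S → W, FiniteMeasure (Λ → W))

/-- `c_Λ`, the maximal total mass of `c_Λ(η, ·)`. -/
def maxRate (c : Rates W S) (Λ : Finset S) : ℝ≥0∞ :=
  ⨆ η : S → W, (c Λ η : Measure (Λ → W)) univ

/-- `c_Λ(u)`, the dependence in total variation of `c_Λ(η, ·)` on the coordinate `η_u`. -/
def rateDependence (c : Rates W S) (Λ : Finset S) (u : S) : ℝ≥0∞ :=
  ⨆ (η : S → W) (η' : S → W) (_ : ∀ y, y ≠ u → η y = η' y),
    ((c Λ η : Measure (Λ → W)).toSignedMeasure -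
      (c Λ η' : Measure (Λ → W)).toSignedMeasure).totalVariation univ

open Classical in
/-- The configuration `η^ζ`, equal to `ζ` on `Λ` and to `η` off `Λ`. -/
def modify {Λ : Finset S} (η : S → W) (ζ : Λ → W) : S → W :=
  fun x => if h : x ∈ Λ then ζ ⟨x, h⟩ else η x

/-- `∫ c_Λ(η, dζ) [f(η^ζ) - f(η)]`. -/
def jumpTerm (c : Rates W S) (f : C(S → W, ℝ)) (η : S → W) (Λ : Finset S) : ℝ :=
  ∫ ζ : Λ → W, (f (modify η ζ) - f η) ∂(c Λ η : Measure (Λ → W))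

/-- `g(η) = ∑_Λ ∫ c_Λ(η, dζ) [f(η^ζ) - f(η)]` for all `η`. -/
def HasFormalGenerator (c : Rates W S) (f g : C(S → W, ℝ)) : Prop :=
  ∀ η, HasSum (jumpTerm c f η) (g η)

theorem continuous_modify {Λ : Finset S} (η : S → W) :
    Continuous fun ζ : Λ → W => modify η ζ := by
  refine continuous_pi fun x => ?_
  by_cases h : x ∈ Λ
  · simpa [modify, h] using continuous_apply (⟨x, h⟩ : Λ)
  · simpa [modify, h] using continuous_const

theorem integrable_jump (c : Rates W S) (f : C(S → W, ℝ)) (η : S → W) (Λ : Finset S) :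
    Integrable (fun ζ : Λ → W => f (modify η ζ) - f η) (c Λ η : Measure (Λ → W)) :=
  ((f.continuous.comp (continuous_modify η)).sub continuous_const).integrable_of_hasCompactSupport
    (HasCompactSupport.of_compactSpace _)

theorem HasFormalGenerator.add {c : Rates W S} {f g f' g' : C(S → W, ℝ)}
    (h : HasFormalGenerator c f g) (h' : HasFormalGenerator c f' g') :
    HasFormalGenerator c (f + f') (g + g') := by
  intro η
  refine ((h η).add (h' η)).congr_fun fun Λ => ?_
  rw [jumpTerm, jumpTerm, jumpTerm,
    ← integral_add (integrable_jump c f η Λ) (integrable_jump c f' η Λ)]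
  congr 1
  funext ζ
  simp only [ContinuousMap.add_apply]
  ring

theorem HasFormalGenerator.smul {c : Rates W S} {f g : C(S → W, ℝ)} (a : ℝ)
    (h : HasFormalGenerator c f g) : HasFormalGenerator c (a • f) (a • g) := by
  intro η
  refine ((h η).mul_left a).congr_fun fun Λ => ?_
  rw [jumpTerm, jumpTerm, ← integral_const_mul]
  congr 1
  funext ζ
  simp [mul_sub]

theorem HasFormalGenerator.unique {c : Rates W S} {f g g' : C(S → W, ℝ)}
    (h : HasFormalGenerator c f g) (h' : HasFormalGenerator c f g') : g = g' :=
  ContinuousMap.ext fun η => (h η).unique (h' η)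

/-- The formal generator `A f(η) = ∑_Λ ∫ c_Λ(η, dζ) [f(η^ζ) - f(η)]`, on all those `f ∈ D` for
which the series converges to a continuous function of `η`. -/
def formalGenerator (c : Rates W S) : C(S → W, ℝ) →ₗ.[ℝ] C(S → W, ℝ) where
  domain :=
    { carrier := {f | f ∈ testFunctions W S ∧ ∃ g, HasFormalGenerator c f g}
      zero_mem' := ⟨zero_mem _, 0, fun η => by
        have : jumpTerm c 0 η = fun _ => 0 := by funext Λ; simp [jumpTerm]
        rw [this]
        exact hasSum_zero⟩
      add_mem' := fun ⟨hf, g, hg⟩ ⟨hf', g', hg'⟩ => ⟨add_mem hf hf', g + g', hg.add hg'⟩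
      smul_mem' := fun a _ ⟨hf, g, hg⟩ => ⟨Submodule.smul_mem _ a hf, a • g, hg.smul a⟩ }
  toFun :=
    { toFun := fun f => Classical.choose f.2.2
      map_add' := fun f f' =>
        (Classical.choose_spec (f + f').2.2).unique
          ((Classical.choose_spec f.2.2).add (Classical.choose_spec f'.2.2))
      map_smul' := fun a f =>
        (Classical.choose_spec (a • f).2.2).unique ((Classical.choose_spec f.2.2).smul a) }

end Rates

end IPS

end

/-!
If only the jumps in a finite family `F` of sets `Λ` are allowed, the generator is bounded and equal
to `m (P - 1)` for a Markov operator `P`, and its semigroup is `exp (t m (P - 1))`. Such a semigroup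
turns a bound `b` on the variations of `f` into the bound `e^{κ t} b`, as soon as `b` is
superharmonic: `∑_Λ c_Λ(x) ∑_{y ∈ Λ} b(y) ≤ κ b(x)` for every `x`. The matrix of influences
`∑_{Λ ∋ y} c_Λ(x)` has bounded column sums, so a Neumann series gives every `f ∈ D` a superharmonic
bound of total mass at most `2 |||f|||`, for a `κ` that depends neither on `f` nor on `F`.

Hence, by Duhamel's formula, the finite semigroups applied to `f ∈ D` are Cauchy, locally uniformly
in time: two of them differ by at most `t e^{κ t}` times the part of `∑_Λ c_Λ ∑_{y ∈ Λ} b(y)` on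
which they disagree. The limit semigroup obeys the same bounds on variations, so it preserves the
dense space `D`, which is therefore a core. On `D` the sup norm continuity of `S(t)` and `V(t)` is
upgraded to `τ_D` by dominated convergence, the variations being dominated by multiples of
`e^{κ t} b`. Finally `‖A f‖ ≤ C |||f|||` and `|||e^f||| ≤ e^{‖f‖} |||f|||` bound the Hamiltonian on
balls of `D`.
-/

theorem hasDerivWithinAt_Ici_of_tendsto_slope_zero {X : Type*} [NormedAddCommGroup X]
    [NormedSpace ℝ X] {u : ℝ → X} {u' : X} {s : ℝ}
    (h : Tendsto (fun r : ℝ => r⁻¹ • (u (s + r) - u s)) (𝓝[>] 0) (𝓝 u')) :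
    HasDerivWithinAt u u' (Ici s) s := by
  rw [← hasDerivWithinAt_Ioi_iff_Ici, hasDerivWithinAt_iff_tendsto_slope' self_notMem_Ioi]
  have h_sub : Tendsto (fun r : ℝ => r - s) (𝓝[>] s) (𝓝[>] 0) := by
    refine tendsto_nhdsWithin_iff.2 ⟨?_, ?_⟩
    · exact ((continuous_sub_right s).tendsto' s 0 (sub_self s)).mono_left nhdsWithin_le_nhds
    · filter_upwards [self_mem_nhdsWithin] with r hr using sub_pos.2 (mem_Ioi.1 hr)
  refine (h.comp h_sub).congr fun r => ?_
  simp only [Function.comp_apply, add_sub_cancel, slope, vsub_eq_sub]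

namespace MarkovSemigroup

variable {E : Type*} [TopologicalSpace E] [CompactSpace E] {T T' : MarkovSemigroup E}
  {f g : C(E, ℝ)}

theorem ext (h : ∀ t, T.op t = T'.op t) : T = T' := by
  cases T; cases T'
  congr
  exact funext h

section Contraction

variable (T)

theorem op_mono (t : ℝ≥0) (h : f ≤ g) : T.op t f ≤ T.op t g := by
  rw [← sub_nonneg, ← map_sub]
  exact T.op_nonneg t _ (sub_nonneg.2 h)

theorem norm_op_le (t : ℝ≥0) (f : C(E, ℝ)) : ‖T.op t f‖ ≤ ‖f‖ := by
  have op_le {g : C(E, ℝ)} (hg : g ≤ ‖f‖ • 1) : T.op t g ≤ ‖f‖ • 1 := by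
    simpa only [map_smul, T.op_one] using T.op_mono t hg
  have h_pos := op_le (g := f) fun x => by
    simpa using (le_abs_self _).trans (f.norm_coe_le_norm x)
  have h_neg := op_le (g := -f) fun x => by
    simpa using (neg_le_abs _).trans (f.norm_coe_le_norm x)
  refine (ContinuousMap.norm_le _ (norm_nonneg _)).2 fun x => abs_le'.2 ⟨?_, ?_⟩
  · simpa using h_pos x
  · simpa using h_neg x

theorem op_mem_Icc (t : ℝ≥0) {f : C(E, ℝ)} {a b : ℝ}
    (hf : ∀ x, f x ∈ Icc a b) (x : E) : T.op t f x ∈ Icc a b := by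
  have h_const (r : ℝ) : T.op t (r • 1) x = r := by
    rw [map_smul, T.op_one, ContinuousMap.smul_apply, ContinuousMap.one_apply, smul_eq_mul, mul_one]
  have h_lower : a • (1 : C(E, ℝ)) ≤ f := fun y => by simpa using (hf y).1
  have h_upper : f ≤ b • (1 : C(E, ℝ)) := fun y => by simpa using (hf y).2
  exact ⟨(h_const a).symm.trans_le (T.op_mono t h_lower x),
    (T.op_mono t h_upper x).trans_eq (h_const b)⟩

theorem op_expFun_mem_Icc (t : ℝ≥0) {f : C(E, ℝ)} {r : ℝ}
    (hf : ‖f‖ ≤ r) (x : E) : T.op t (expFun f) x ∈ Icc (Real.exp (-r)) (Real.exp r) :=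
  T.op_mem_Icc t (fun y => by
    have h_abs := abs_le.1 ((f.norm_coe_le_norm y).trans hf)
    exact ⟨Real.exp_le_exp.2 h_abs.1, Real.exp_le_exp.2 h_abs.2⟩) x

theorem norm_op_sub_le (t : ℝ≥0) (f g : C(E, ℝ)) : ‖T.op t f - T.op t g‖ ≤ ‖f - g‖ := by
  simpa only [map_sub] using T.norm_op_le t (f - g)

theorem op_add_apply (s t : ℝ≥0) (f : C(E, ℝ)) : T.op (s + t) f = T.op s (T.op t f) := by
  rw [T.op_add, ContinuousLinearMap.comp_apply]

theorem op_zero_apply (f : C(E, ℝ)) : T.op 0 f = f := by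
  rw [T.op_zero, ContinuousLinearMap.id_apply]

theorem continuous_op_toNNReal (f : C(E, ℝ)) : Continuous fun s : ℝ => T.op s.toNNReal f :=
  (T.continuous_op f).comp continuous_real_toNNReal

theorem intervalIntegrable_op (f : C(E, ℝ)) (a b : ℝ) :
    IntervalIntegrable (fun s : ℝ => T.op s.toNNReal f) volume a b :=
  (T.continuous_op_toNNReal f).intervalIntegrable a b

end Contraction

theorem tendsto_op_of_tendsto {ι : Type*} {l : Filter ι} {U : ι → MarkovSemigroup E}
    {t : ι → ℝ≥0} {u : ι → C(E, ℝ)} (hu : Tendsto u l (𝓝 f))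
    (hU : Tendsto (fun i => (U i).op (t i) f) l (𝓝 g)) :
    Tendsto (fun i => (U i).op (t i) (u i)) l (𝓝 g) := by
  have h_sub : Tendsto (fun i => (U i).op (t i) (u i) - (U i).op (t i) f) l (𝓝 0) :=
    squeeze_zero_norm (fun i => (U i).norm_op_sub_le _ _ _)
      (tendsto_iff_norm_sub_tendsto_zero.1 hu)
  simpa using h_sub.add hU

theorem tendsto_op (T : MarkovSemigroup E) {ι : Type*} {l : Filter ι} {t : ι → ℝ≥0} {t₀ : ℝ≥0}
    {u : ι → C(E, ℝ)} (ht : Tendsto t l (𝓝 t₀)) (hu : Tendsto u l (𝓝 f)) :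
    Tendsto (fun i => T.op (t i) (u i)) l (𝓝 (T.op t₀ f)) :=
  tendsto_op_of_tendsto (U := fun _ => T) hu (((T.continuous_op f).tendsto t₀).comp ht)

section Derivative

theorem hasGenerator_iff_real :
    T.HasGenerator f g ↔
      Tendsto (fun h : ℝ => h⁻¹ • (T.op h.toNNReal f - f)) (𝓝[>] 0) (𝓝 g) := by
  rw [HasGenerator, ← NNReal.coe_zero, ← NNReal.map_coe_nhdsGT, tendsto_map'_iff]
  simp only [Function.comp_def, Real.toNNReal_coe]

theorem HasGenerator.op (h : T.HasGenerator f g) (s : ℝ≥0) :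
    T.HasGenerator (T.op s f) (T.op s g) := by
  refine (((T.op s).continuous.tendsto g).comp h).congr fun t => ?_
  rw [Function.comp_apply, map_smul, map_sub, ← T.op_add_apply, ← T.op_add_apply, add_comm]

theorem HasGenerator.hasDerivWithinAt (h : T.HasGenerator f g) {s : ℝ} (hs : 0 ≤ s) :
    HasDerivWithinAt (fun s : ℝ => T.op s.toNNReal f) (T.op s.toNNReal g) (Ici s) s := by
  refine hasDerivWithinAt_Ici_of_tendsto_slope_zero
    ((hasGenerator_iff_real.1 (h.op s.toNNReal)).congr' ?_)
  filter_upwards [self_mem_nhdsWithin] with r hr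
  rw [add_comm, Real.toNNReal_add (le_of_lt hr) hs, T.op_add_apply]

theorem HasGenerator.integral_eq (h : T.HasGenerator f g) {t : ℝ} (ht : 0 ≤ t) :
    ∫ s in (0 : ℝ)..t, T.op s.toNNReal g = T.op t.toNNReal f - f := by
  rw [intervalIntegral.integral_eq_sub_of_hasDeriv_right_of_le ht
    (T.continuous_op_toNNReal f).continuousOn
    (fun s hs => (h.hasDerivWithinAt hs.1.le).mono Ioi_subset_Ici_self)
    (T.intervalIntegrable_op g _ _), Real.toNNReal_zero, T.op_zero_apply]

theorem tendsto_average (T : MarkovSemigroup E) (g : C(E, ℝ)) :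
    Tendsto (fun h : ℝ => h⁻¹ • ∫ s in (0 : ℝ)..h, T.op s.toNNReal g) (𝓝[>] 0) (𝓝 g) := by
  have h_deriv : HasDerivAt (fun h : ℝ => ∫ s in (0 : ℝ)..h, T.op s.toNNReal g) g 0 := by
    simpa [T.op_zero_apply] using
      ((T.continuous_op_toNNReal g).integral_hasStrictDerivAt 0 0).hasDerivAt
  simpa using h_deriv.tendsto_slope_zero_right

theorem hasGenerator_of_integral_eq
    (h : ∀ t : ℝ, 0 ≤ t → ∫ s in (0 : ℝ)..t, T.op s.toNNReal g = T.op t.toNNReal f - f) :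
    T.HasGenerator f g := by
  refine hasGenerator_iff_real.2 ((T.tendsto_average g).congr' ?_)
  filter_upwards [self_mem_nhdsWithin] with t ht
  rw [h t (le_of_lt ht)]

end Derivative

section Limits

variable {ι : Type*} {l : Filter ι} [l.IsCountablyGenerated] {U : ι → MarkovSemigroup E}
  {u v : ι → C(E, ℝ)}

theorem tendsto_integral_op (hv : Tendsto v l (𝓝 g))
    (hU : ∀ t, Tendsto (fun i => (U i).op t g) l (𝓝 (T.op t g))) (t : ℝ) :
    Tendsto (fun i => ∫ s in (0 : ℝ)..t, (U i).op s.toNNReal (v i)) l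
      (𝓝 (∫ s in (0 : ℝ)..t, T.op s.toNNReal g)) := by
  have h_bound : ∀ᶠ i in l, ‖v i‖ < ‖g‖ + 1 := hv.norm.eventually_lt_const (lt_add_one _)
  refine intervalIntegral.tendsto_integral_filter_of_dominated_convergence (fun _ => ‖g‖ + 1)
    ?_ ?_ intervalIntegrable_const ?_
  · exact .of_forall fun i => ((U i).continuous_op_toNNReal _).aestronglyMeasurable
  · filter_upwards [h_bound] with i hi
    exact .of_forall fun s _ => ((U i).norm_op_le _ _).trans hi.le
  · exact .of_forall fun s _ => tendsto_op_of_tendsto hv (hU s.toNNReal)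

theorem HasGenerator.of_tendsto [l.NeBot] (hU : ∀ i, (U i).HasGenerator (u i) (v i))
    (hu : Tendsto u l (𝓝 f)) (hv : Tendsto v l (𝓝 g))
    (hT : ∀ t f, Tendsto (fun i => (U i).op t f) l (𝓝 (T.op t f))) :
    T.HasGenerator f g := by
  refine hasGenerator_of_integral_eq fun t ht => ?_
  refine tendsto_nhds_unique (tendsto_integral_op hv (hT · g) t) ?_
  simp_rw [fun i => (hU i).integral_eq ht]
  exact (tendsto_op_of_tendsto hu (hT t.toNNReal f)).sub hu

end Limits

theorem isClosed_hasGenerator (T : MarkovSemigroup E) :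
    IsClosed {p : C(E, ℝ) × C(E, ℝ) | T.HasGenerator p.1 p.2} :=
  IsSeqClosed.isClosed fun _ p hu hp => .of_tendsto (l := atTop) (U := fun _ => T) hu
    ((continuous_fst.tendsto p).comp hp) ((continuous_snd.tendsto p).comp hp)
    fun _ _ => tendsto_const_nhds

section Comparison

theorem hasDerivWithinAt_op_sub_op {t s : ℝ≥0} (hst : s < t) {g' : C(E, ℝ)}
    (hg : T.HasGenerator (T'.op s f) g) (hg' : T'.HasGenerator (T'.op s f) g') :
    HasDerivWithinAt (fun r : ℝ => T.op (t - r.toNNReal) (T'.op r.toNNReal f))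
      (T.op (t - s) (g' - g)) (Ici s) s := by
  have h_time : Tendsto (fun r : ℝ => t - (s + r).toNNReal) (𝓝[>] 0) (𝓝 (t - s)) := by
    refine Tendsto.mono_left ?_ nhdsWithin_le_nhds
    exact (continuous_const.sub (continuous_real_toNNReal.comp
      (continuous_const_add _))).tendsto' _ _ (by simp)
  have h_small : ∀ᶠ r : ℝ in 𝓝[>] 0, r < t - s :=
    nhdsWithin_le_nhds (gt_mem_nhds (sub_pos.2 (NNReal.coe_lt_coe.2 hst)))
  refine hasDerivWithinAt_Ici_of_tendsto_slope_zero ((T.tendsto_op h_time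
    ((hasGenerator_iff_real.1 hg').sub (hasGenerator_iff_real.1 hg))).congr' ?_)
  filter_upwards [self_mem_nhdsWithin, h_small] with r hr hrt
  lift r to ℝ≥0 using le_of_lt hr
  have hrt' : s + r ≤ t := by
    rw [← NNReal.coe_le_coe, NNReal.coe_add]; linarith
  have h_split : T.op (t - s) (T'.op s f) = T.op (t - (s + r)) (T.op r (T'.op s f)) := by
    rw [← T.op_add_apply, ← tsub_tsub, tsub_add_cancel_of_le (le_tsub_of_add_le_left hrt')]
  rw [← NNReal.coe_add, Real.toNNReal_coe, Real.toNNReal_coe, Real.toNNReal_coe, h_split,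
    add_comm s r, T'.op_add_apply, ← map_sub, ← smul_sub, map_smul, sub_sub_sub_cancel_right]

theorem norm_op_sub_op_le {t : ℝ≥0} {ε : ℝ}
    (h : ∀ s ≤ t, ∃ g g', T.HasGenerator (T'.op s f) g ∧ T'.HasGenerator (T'.op s f) g' ∧
      ‖g' - g‖ ≤ ε) :
    ‖T'.op t f - T.op t f‖ ≤ ε * t := by
  choose! g g' hg hg' hε using h
  have h_cont : Continuous fun s : ℝ => T.op (t - s.toNNReal) (T'.op s.toNNReal f) :=
    continuous_iff_continuousAt.2 fun s => T.tendsto_op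
      ((continuous_const.sub continuous_real_toNNReal).tendsto s)
      ((T'.continuous_op_toNNReal f).tendsto s)
  have h_mvt := norm_image_sub_le_of_norm_deriv_right_le_segment (a := 0) (b := t) (C := ε)
    (f' := fun s => T.op (t - s.toNNReal) (g' s.toNNReal - g s.toNNReal)) h_cont.continuousOn
    (fun s hs => ?_) (fun s hs => ?_) t ⟨t.2, le_rfl⟩
  · simpa [T.op_zero_apply, T'.op_zero_apply] using h_mvt
  all_goals
    lift s to ℝ≥0 using hs.1
    have hst : s < t := by exact_mod_cast hs.2
    rw [Real.toNNReal_coe]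
  · exact hasDerivWithinAt_op_sub_op hst (hg s hst.le) (hg' s hst.le)
  · exact (T.norm_op_le _ _).trans (hε s hst.le)

end Comparison

section Generator

theorem mem_graph_generator {p : C(E, ℝ) × C(E, ℝ)} :
    p ∈ T.generator.graph ↔ T.HasGenerator p.1 p.2 := by
  rw [LinearPMap.mem_graph_iff]
  constructor
  · rintro ⟨y, hy, hy'⟩
    rw [← hy, ← hy']
    exact Classical.choose_spec y.2
  · intro h
    exact ⟨⟨p.1, p.2, h⟩, rfl, (Classical.choose_spec (⟨p.2, h⟩ : ∃ g, _)).unique h⟩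

theorem isClosed_generator (T : MarkovSemigroup E) : T.generator.IsClosed := by
  have h_graph : (T.generator.graph : Set (C(E, ℝ) × C(E, ℝ))) = {p | T.HasGenerator p.1 p.2} :=
    Set.ext fun _ => mem_graph_generator
  rw [LinearPMap.IsClosed, h_graph]
  exact T.isClosed_hasGenerator

theorem hasGenerator_generator (f : T.generator.domain) : T.HasGenerator f (T.generator f) :=
  Classical.choose_spec f.2

theorem HasGenerator.generator_eq (h : T.HasGenerator f g) (hf : f ∈ T.generator.domain) :
    T.generator ⟨f, hf⟩ = g :=
  (hasGenerator_generator ⟨f, hf⟩).unique h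

theorem eq_of_generator_eq (h : T.generator = T'.generator)
    (h_dense : Dense (T.generator.domain : Set C(E, ℝ))) : T = T' := by
  have h_iff : ∀ f g, T.HasGenerator f g ↔ T'.HasGenerator f g := fun f g => by
    rw [← mem_graph_generator (p := (f, g)), ← mem_graph_generator (p := (f, g)), h]
  refine ext fun t => ContinuousLinearMap.coeFn_injective
    (Continuous.ext_on h_dense (T.op t).continuous (T'.op t).continuous ?_)
  rintro f ⟨g, hg⟩
  have h_le : ‖T.op t f - T'.op t f‖ ≤ 0 * t := norm_op_sub_op_le fun s _ =>
    ⟨T.op s g, T.op s g, (h_iff _ _).1 (hg.op s), hg.op s, by simp⟩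
  rwa [zero_mul, norm_le_zero_iff, sub_eq_zero] at h_le

end Generator

section Core

variable {G : Submodule ℝ (C(E, ℝ) × C(E, ℝ))}

theorem continuous_integral_op (T : MarkovSemigroup E) (t : ℝ) :
    Continuous fun f => ∫ s in (0 : ℝ)..t, T.op s.toNNReal f :=
  continuous_iff_continuousAt.2 fun _ =>
    tendsto_integral_op (U := fun _ => T) tendsto_id (fun _ => tendsto_const_nhds) t

theorem HasGenerator.integral_op_mem (hG : IsClosed (G : Set (C(E, ℝ) × C(E, ℝ))))
    (h : T.HasGenerator f g) (h_mem : ∀ t, (T.op t f, T.op t g) ∈ G) {t : ℝ} (ht : 0 < t) :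
    (∫ s in (0 : ℝ)..t, T.op s.toNNReal f, T.op t.toNNReal f - f) ∈ G := by
  have h_cont : Continuous fun s : ℝ => (T.op s.toNNReal f, T.op s.toNNReal g) :=
    (T.continuous_op_toNNReal f).prodMk (T.continuous_op_toNNReal g)
  have h_int := h_cont.intervalIntegrable (μ := volume) 0 t
  have h_eq : (∫ s in (0 : ℝ)..t, T.op s.toNNReal f, T.op t.toNNReal f - f) =
      ∫ s in (0 : ℝ)..t, (T.op s.toNNReal f, T.op s.toNNReal g) := by
    rw [← h.integral_eq ht.le]
    exact Prod.ext ((ContinuousLinearMap.fst ℝ C(E, ℝ) C(E, ℝ)).intervalIntegral_comp_comm h_int)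
      ((ContinuousLinearMap.snd ℝ C(E, ℝ) C(E, ℝ)).intervalIntegral_comp_comm h_int)
  have h_avg := G.convex.set_average_mem (μ := volume) (t := Ioc 0 t) hG (by simpa using ht)
    (by simp) (.of_forall fun s => h_mem s.toNNReal)
    (h_cont.integrableOn_Icc.mono_set Ioc_subset_Icc_self)
  rw [setAverage_eq, ← intervalIntegral.integral_of_le ht.le] at h_avg
  rw [h_eq]
  simpa [smul_smul, ht.ne', ht.le] using G.smul_mem t h_avg

theorem HasGenerator.mem_of_dense_invariant (hG : IsClosed (G : Set (C(E, ℝ) × C(E, ℝ))))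
    {D : Set C(E, ℝ)} (hD : Dense D)
    (h : ∀ f ∈ D, ∃ g, T.HasGenerator f g ∧ ∀ t, (T.op t f, T.op t g) ∈ G)
    (hfg : T.HasGenerator f g) : (f, g) ∈ G := by
  have h_int : ∀ t : ℝ, 0 < t → ∀ f,
      (∫ s in (0 : ℝ)..t, T.op s.toNNReal f, T.op t.toNNReal f - f) ∈ G := by
    intro t ht f
    have h_cont : Continuous fun f =>
        (∫ s in (0 : ℝ)..t, T.op s.toNNReal f, T.op t.toNNReal f - f) :=
      (T.continuous_integral_op t).prodMk (by fun_prop)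
    refine (hG.preimage h_cont).closure_subset_iff.2 (fun f hf => ?_) (hD f)
    obtain ⟨g, hg, h_mem⟩ := h f hf
    exact hg.integral_op_mem hG h_mem ht
  have h_lim : Tendsto (fun t : ℝ => t⁻¹ • (∫ s in (0 : ℝ)..t, T.op s.toNNReal f,
      T.op t.toNNReal f - f)) (𝓝[>] 0) (𝓝 (f, g)) :=
    (T.tendsto_average f).prodMk_nhds (hasGenerator_iff_real.1 hfg)
  refine hG.mem_of_tendsto h_lim ?_
  filter_upwards [self_mem_nhdsWithin] with t ht
  exact G.smul_mem _ (h_int t ht f)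

end Core

end MarkovSemigroup

section Uniformization

variable {X : Type*} [NormedAddCommGroup X] [NormedSpace ℝ X]

/-- The operator `exp (a (P - 1))`: a Markov chain with transition operator `P`, run at the times
of a Poisson process up to time `a`. -/
noncomputable def uniformization (P : X →L[ℝ] X) (a : ℝ) : X →L[ℝ] X :=
  NormedSpace.exp (a • (P - 1))

variable (P : X →L[ℝ] X)

theorem uniformization_zero : uniformization P 0 = ContinuousLinearMap.id ℝ X := by
  rw [uniformization, zero_smul, NormedSpace.exp_zero, ContinuousLinearMap.one_def]

variable [CompleteSpace X]

theorem uniformization_add (a b : ℝ) :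
    uniformization P (a + b) = (uniformization P a).comp (uniformization P b) := by
  let _ : NormedAlgebra ℚ (X →L[ℝ] X) := .restrictScalars ℚ ℝ _
  rw [uniformization, add_smul, NormedSpace.exp_add_of_commute
    (((Commute.refl (P - 1)).smul_left _).smul_right _), ← ContinuousLinearMap.mul_def]
  rfl

theorem uniformization_eq_smul_exp (a : ℝ) :
    uniformization P a = Real.exp (-a) • NormedSpace.exp (a • P) := by
  let _ : NormedAlgebra ℚ (X →L[ℝ] X) := .restrictScalars ℚ ℝ _
  have h_split : a • (P - 1) = algebraMap ℝ (X →L[ℝ] X) (-a) + a • P := by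
    rw [Algebra.algebraMap_eq_smul_one, smul_sub, neg_smul]; abel
  rw [uniformization, h_split, NormedSpace.exp_add_of_commute (Algebra.commutes _ _),
    ← NormedSpace.algebraMap_exp_comm, ← Real.exp_eq_exp_ℝ, Algebra.algebraMap_eq_smul_one,
    smul_mul_assoc, one_mul]

theorem hasSum_uniformization (a : ℝ) (f : X) :
    HasSum (fun n : ℕ => (Real.exp (-a) * ((n.factorial : ℝ)⁻¹ * a ^ n)) • (P ^ n) f)
      (uniformization P a f) := by
  have h_exp := (NormedSpace.exp_series_hasSum_exp' (𝕂 := ℝ) (a • P)).const_smul (Real.exp (-a))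
  rw [uniformization_eq_smul_exp]
  refine (h_exp.mapL (ContinuousLinearMap.apply ℝ X f)).congr_fun fun n => ?_
  simp [smul_pow, smul_smul]

theorem abs_uniformization_le {a r β : ℝ} (ha : 0 ≤ a) (ℓ : X →L[ℝ] ℝ) (f : X)
    (h : ∀ n : ℕ, |ℓ ((P ^ n) f)| ≤ r ^ n * β) :
    |ℓ (uniformization P a f)| ≤ Real.exp (a * (r - 1)) * β := by
  have h_poisson : HasSum (fun n : ℕ => Real.exp (-a) * ((n.factorial : ℝ)⁻¹ * (a * r) ^ n) * β)
      (Real.exp (a * (r - 1)) * β) := by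
    have h_exp := NormedSpace.exp_series_hasSum_exp' (𝕂 := ℝ) (a * r)
    rw [← Real.exp_eq_exp_ℝ] at h_exp
    rw [show a * (r - 1) = -a + a * r by ring, Real.exp_add]
    exact (h_exp.mul_left (Real.exp (-a))).mul_right β
  rw [← Real.norm_eq_abs, ← ((hasSum_uniformization P a f).mapL ℓ).tsum_eq]
  refine tsum_of_norm_bounded h_poisson fun n => ?_
  rw [map_smul, smul_eq_mul, norm_mul, Real.norm_of_nonneg (by positivity), Real.norm_eq_abs]
  calc Real.exp (-a) * ((n.factorial : ℝ)⁻¹ * a ^ n) * |ℓ ((P ^ n) f)|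
      ≤ Real.exp (-a) * ((n.factorial : ℝ)⁻¹ * a ^ n) * (r ^ n * β) := by gcongr; exact h n
    _ = Real.exp (-a) * ((n.factorial : ℝ)⁻¹ * (a * r) ^ n) * β := by ring

theorem hasDerivAt_uniformization (f : X) (a : ℝ) :
    HasDerivAt (fun a => uniformization P a f) (uniformization P a (P f - f)) a := by
  simpa [uniformization] using
    (hasDerivAt_exp_smul_const (𝕂 := ℝ) (P - 1) a).clm_apply (hasDerivAt_const a f)

theorem continuous_uniformization (f : X) : Continuous fun a => uniformization P a f :=
  continuous_iff_continuousAt.2 fun a => (hasDerivAt_uniformization P f a).continuousAt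

theorem uniformization_apply_of_fixed {P : X →L[ℝ] X} {f : X} (h : P f = f) (a : ℝ) :
    uniformization P a f = f := by
  have h_deriv : ∀ a, HasDerivAt (fun a => uniformization P a f) 0 a := fun a => by
    simpa [h] using hasDerivAt_uniformization P f a
  simpa [uniformization_zero] using is_const_of_deriv_eq_zero
    (fun a => (h_deriv a).differentiableAt) (fun a => (h_deriv a).deriv) a 0

end Uniformization

namespace MarkovSemigroup

variable {E : Type*} [TopologicalSpace E] [CompactSpace E]

section OfPositive

variable (P : C(E, ℝ) →L[ℝ] C(E, ℝ))

theorem uniformization_nonneg (hP : ∀ f, 0 ≤ f → 0 ≤ P f) {a : ℝ} (ha : 0 ≤ a) {f : C(E, ℝ)}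
    (hf : 0 ≤ f) : 0 ≤ uniformization P a f := fun x => by
  have h_pow (n : ℕ) : 0 ≤ (P ^ n) f := by
    induction n with
    | zero => simpa using hf
    | succ n ih => rw [pow_succ']; exact hP _ ih
  refine ((hasSum_uniformization P a f).mapL (ContinuousMap.evalCLM ℝ x)).nonneg fun n => ?_
  rw [map_smul, smul_eq_mul]
  exact mul_nonneg (by positivity) (h_pow n x)

variable (hP : ∀ f, 0 ≤ f → 0 ≤ P f) (hP1 : P 1 = 1) (m : ℝ≥0)

/-- The semigroup of the Markov jump process with jump rate `m` and transition operator `P`. -/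
noncomputable def ofPositive : MarkovSemigroup E where
  op t := uniformization P (t * m)
  op_zero := by rw [NNReal.coe_zero, zero_mul, uniformization_zero]
  op_add s t := by rw [NNReal.coe_add, add_mul, uniformization_add]
  op_nonneg t _ hf := uniformization_nonneg P hP (by positivity) hf
  op_one t := uniformization_apply_of_fixed hP1 _
  continuous_op f := (continuous_uniformization P f).comp
    (by fun_prop : Continuous fun t : ℝ≥0 => (t * m : ℝ))

theorem hasGenerator_ofPositive (f : C(E, ℝ)) :
    (ofPositive P hP hP1 m).HasGenerator f ((m : ℝ) • (P f - f)) := by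
  have h_deriv : HasDerivAt (fun t : ℝ => uniformization P (t * m) f)
      ((m : ℝ) • (P f - f)) 0 := by
    have h_comp := HasDerivAt.scomp (0 : ℝ)
      (hasDerivAt_uniformization P f (0 * (m : ℝ))) (hasDerivAt_mul_const (m : ℝ))
    rwa [zero_mul, uniformization_zero] at h_comp
  refine hasGenerator_iff_real.2 (h_deriv.tendsto_slope_zero_right.congr' ?_)
  filter_upwards [self_mem_nhdsWithin] with t ht
  simp [ofPositive, uniformization_zero, Real.coe_toNNReal t (le_of_lt ht)]

end OfPositive

section Limit

variable {ι : Type*} {l : Filter ι} {U : ι → MarkovSemigroup E}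

theorem uniformCauchySeqOn_of_dense {D : Set C(E, ℝ)} (hD : Dense D) {K : Set ℝ≥0}
    (h : ∀ f ∈ D, UniformCauchySeqOn (fun i t => (U i).op t f) l K) (f : C(E, ℝ)) :
    UniformCauchySeqOn (fun i t => (U i).op t f) l K := by
  intro V hV
  obtain ⟨ε, hε, hεV⟩ := Metric.mem_uniformity_dist.1 hV
  obtain ⟨g, hg, hgD⟩ := Metric.dense_iff.1 hD f (ε / 3) (by positivity)
  rw [mem_ball_iff_norm] at hg
  filter_upwards [h g hgD _ (Metric.dist_mem_uniformity (show 0 < ε / 3 by positivity))]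
    with ⟨i, j⟩ hij t ht
  have h_near (k : ι) : ‖(U k).op t g - (U k).op t f‖ < ε / 3 :=
    ((U k).norm_op_sub_le t g f).trans_lt hg
  refine hεV ?_
  calc dist ((U i).op t f) ((U j).op t f)
      ≤ dist ((U i).op t f) ((U i).op t g) + dist ((U i).op t g) ((U j).op t g) +
        dist ((U j).op t g) ((U j).op t f) := dist_triangle4 _ _ _ _
    _ < ε / 3 + ε / 3 + ε / 3 := by
        refine add_lt_add (add_lt_add ?_ (hij t ht)) ?_
        · rw [dist_comm, dist_eq_norm]; exact h_near i
        · rw [dist_eq_norm]; exact h_near j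
    _ = ε := by ring

variable [l.NeBot] [l.IsCountablyGenerated]

/-- The limit of a family of Markov semigroups that converges strongly, uniformly on bounded time
intervals. -/
noncomputable def ofTendstoUniformlyOn (U : ι → MarkovSemigroup E)
    (L : ℝ≥0 → C(E, ℝ) → C(E, ℝ))
    (h : ∀ f t₀, TendstoUniformlyOn (fun i t => (U i).op t f) (fun t => L t f) l (Iic t₀)) :
    MarkovSemigroup E :=
  have h_lim : ∀ t f, Tendsto (fun i => (U i).op t f) l (𝓝 (L t f)) := fun t f =>
    (h f t).tendsto_at self_mem_Iic
  { op := fun t => continuousLinearMapOfTendsto (fun i => (U i).op t) (tendsto_pi_nhds.2 (h_lim t))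
    op_zero := ContinuousLinearMap.ext fun f => tendsto_nhds_unique (h_lim 0 f) <| by
      simp only [op_zero_apply, ContinuousLinearMap.id_apply, tendsto_const_nhds]
    op_add := fun s t => ContinuousLinearMap.ext fun f =>
      tendsto_nhds_unique (h_lim (s + t) f) <| by
        simp only [op_add_apply]
        exact tendsto_op_of_tendsto (h_lim t f) (h_lim s _)
    op_nonneg := fun t f hf x => ge_of_tendsto
      (((ContinuousMap.evalCLM ℝ x).continuous.tendsto _).comp (h_lim t f))
      (.of_forall fun i => (U i).op_nonneg t f hf x)
    op_one := fun t => tendsto_nhds_unique (h_lim t 1) <| by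
      simp only [op_one, tendsto_const_nhds]
    continuous_op := fun f => continuous_iff_continuousAt.2 fun t =>
      ((h f (t + 1)).continuousOn (.of_forall fun i =>
        ((U i).continuous_op f).continuousOn)).continuousAt (Iic_mem_nhds (lt_add_one t)) }

theorem exists_tendsto_of_uniformCauchySeqOn {D : Set C(E, ℝ)} (hD : Dense D)
    (h : ∀ f ∈ D, ∀ t₀, UniformCauchySeqOn (fun i t => (U i).op t f) l (Iic t₀)) :
    ∃ T : MarkovSemigroup E, ∀ t f, Tendsto (fun i => (U i).op t f) l (𝓝 (T.op t f)) := by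
  have h_cauchy (f : C(E, ℝ)) (t₀ : ℝ≥0) :
      UniformCauchySeqOn (fun i t => (U i).op t f) l (Iic t₀) :=
    uniformCauchySeqOn_of_dense hD (fun g hg => h g hg t₀) f
  choose L hL using fun (t : ℝ≥0) (f : C(E, ℝ)) =>
    cauchy_map_iff_exists_tendsto.1 ((h_cauchy f t).cauchy_map self_mem_Iic)
  exact ⟨ofTendstoUniformlyOn U L fun f t₀ =>
    (h_cauchy f t₀).tendstoUniformlyOn_of_tendsto fun t _ => hL t f, hL⟩

end Limit

end MarkovSemigroup

namespace IPS

section Variation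

variable {W S : Type*} [TopologicalSpace W] {f : C(S → W, ℝ)} {x : S}

theorem variation_le_iff {a : ℝ≥0∞} :
    variation f x ≤ a ↔
      ∀ η ζ : S → W, (∀ y, y ≠ x → η y = ζ y) → ENNReal.ofReal |f η - f ζ| ≤ a := by
  simp only [variation, iSup_le_iff]

theorem le_variation (f : C(S → W, ℝ)) {η ζ : S → W} (h : ∀ y, y ≠ x → η y = ζ y) :
    ENNReal.ofReal |f η - f ζ| ≤ variation f x :=
  variation_le_iff.1 le_rfl η ζ h

theorem variation_comp_le {L : ℝ≥0} {φ : ℝ → ℝ} {K : Set ℝ} (hφ : LipschitzOnWith L φ K)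
    {g : C(S → W, ℝ)} (hf : ∀ η, f η ∈ K) (hg : ∀ η, g η = φ (f η)) (x : S) :
    variation g x ≤ L * variation f x := by
  refine variation_le_iff.2 fun η ζ h => ?_
  have h_lip : |g η - g ζ| ≤ L * |f η - f ζ| := by
    simpa only [Real.dist_eq, ← hg] using hφ.dist_le_mul _ (hf η) _ (hf ζ)
  calc ENNReal.ofReal |g η - g ζ|
      ≤ ENNReal.ofReal (L * |f η - f ζ|) := ENNReal.ofReal_le_ofReal h_lip
    _ = L * ENNReal.ofReal |f η - f ζ| := by
        rw [ENNReal.ofReal_mul L.coe_nonneg, ENNReal.ofReal_coe_nnreal]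
    _ ≤ L * variation f x := by gcongr; exact le_variation f h

/-- `b` bounds the variations `Δ_f` from above. The bounds are real-valued, and not extended
nonnegative like `Δ_f`, since they are compared with integrals. -/
def IsVariationBound (f : C(S → W, ℝ)) (b : S → ℝ) : Prop :=
  ∀ x, ∀ η ζ : S → W, (∀ y, y ≠ x → η y = ζ y) → |f η - f ζ| ≤ b x

namespace IsVariationBound

variable {b : S → ℝ}

theorem variation_le (h : IsVariationBound f b) (x : S) : variation f x ≤ ENNReal.ofReal (b x) :=
  variation_le_iff.2 fun η ζ hηζ => ENNReal.ofReal_le_ofReal (h x η ζ hηζ)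

theorem tripleNorm_le (h : IsVariationBound f b) :
    tripleNorm f ≤ ∑' x, ENNReal.ofReal (b x) :=
  ENNReal.tsum_le_tsum h.variation_le

theorem mono {b' : S → ℝ} (h : IsVariationBound f b) (hb : ∀ x, b x ≤ b' x) :
    IsVariationBound f b' :=
  fun x η ζ hηζ => (h x η ζ hηζ).trans (hb x)

theorem of_tendsto {ι : Type*} {l : Filter ι} [l.NeBot] {u : ι → C(S → W, ℝ)}
    (hu : Tendsto u l (𝓝 f)) (h : ∀ i, IsVariationBound (u i) b) : IsVariationBound f b := by
  intro x η ζ hηζ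
  have h_cont : Continuous fun g : C(S → W, ℝ) => |g η - g ζ| :=
    ((continuous_eval_const η).sub (continuous_eval_const ζ)).abs
  exact le_of_tendsto ((h_cont.tendsto f).comp hu) (.of_forall fun i => h i x η ζ hηζ)

theorem abs_sub_le_sum (hf : IsVariationBound f b) (F : Finset S) {η ζ : S → W}
    (h : ∀ y, y ∉ F → η y = ζ y) : |f η - f ζ| ≤ ∑ x ∈ F, b x := by
  classical
  induction F using Finset.induction_on generalizing η with
  | empty =>
    obtain rfl : η = ζ := funext fun y => h y (Finset.notMem_empty y)
    simp
  | insert x F hx ih =>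
    rw [Finset.sum_insert hx]
    refine (abs_sub_le _ (f (Function.update η x (ζ x))) _).trans (add_le_add ?_ ?_)
    · exact hf x _ _ fun y hy => (Function.update_of_ne hy _ _).symm
    · refine ih fun y hy => ?_
      obtain rfl | hyx := eq_or_ne y x
      · exact Function.update_self ..
      · rw [Function.update_of_ne hyx]
        exact h y (by simp [hyx, hy])

end IsVariationBound

theorem lowerSemicontinuous_variation (x : S) :
    LowerSemicontinuous fun f : C(S → W, ℝ) => variation f x :=
  lowerSemicontinuous_iSup fun η => lowerSemicontinuous_iSup fun ζ =>
    lowerSemicontinuous_iSup fun _ => Continuous.lowerSemicontinuous <|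
      ENNReal.continuous_ofReal.comp ((continuous_eval_const η).sub (continuous_eval_const ζ)).abs

theorem lowerSemicontinuous_tripleNorm :
    LowerSemicontinuous (tripleNorm : C(S → W, ℝ) → ℝ≥0∞) :=
  lowerSemicontinuous_tsum lowerSemicontinuous_variation

variable [CompactSpace W]

theorem variation_neg (f : C(S → W, ℝ)) (x : S) : variation (-f) x = variation f x := by
  simpa using variation_smul (-1) f x

theorem variation_sub_comm (f g : C(S → W, ℝ)) (x : S) :
    variation (f - g) x = variation (g - f) x := by
  rw [← variation_neg, neg_sub]

theorem variation_sub_le (f g : C(S → W, ℝ)) (x : S) :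
    variation (f - g) x ≤ variation f x + variation g x := by
  rw [sub_eq_add_neg, ← variation_neg g]
  exact variation_add_le f (-g) x

theorem variation_le_add_sub (f g : C(S → W, ℝ)) (x : S) :
    variation f x ≤ variation g x + variation (f - g) x := by
  simpa using variation_add_le g (f - g) x

theorem tripleNorm_sub_comm (f g : C(S → W, ℝ)) : tripleNorm (f - g) = tripleNorm (g - f) :=
  tsum_congr (variation_sub_comm f g)

theorem variation_le_norm (f : C(S → W, ℝ)) (x : S) :
    variation f x ≤ ENNReal.ofReal (2 * ‖f‖) :=
  variation_le_iff.2 fun η ζ _ => ENNReal.ofReal_le_ofReal <| by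
    simpa only [Real.dist_eq] using f.dist_le_two_norm η ζ

theorem variation_ne_top (f : C(S → W, ℝ)) (x : S) : variation f x ≠ ⊤ :=
  ((variation_le_norm f x).trans_lt ENNReal.ofReal_lt_top).ne

theorem isVariationBound_variation (f : C(S → W, ℝ)) :
    IsVariationBound f fun x => (variation f x).toReal := fun x η ζ h => by
  rw [← ENNReal.ofReal_le_iff_le_toReal (variation_ne_top f x)]
  exact le_variation f h

theorem tsum_ofReal_variation (f : C(S → W, ℝ)) :
    ∑' x, ENNReal.ofReal (variation f x).toReal = tripleNorm f :=
  tsum_congr fun x => ENNReal.ofReal_toReal (variation_ne_top f x)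

theorem variation_mul_le (f g : C(S → W, ℝ)) (x : S) :
    variation (f * g) x ≤
      ENNReal.ofReal ‖f‖ * variation g x + ENNReal.ofReal ‖g‖ * variation f x := by
  refine variation_le_iff.2 fun η ζ h => ?_
  have h_leibniz : (f * g) η - (f * g) ζ = f η * (g η - g ζ) + g ζ * (f η - f ζ) := by
    simp only [ContinuousMap.mul_apply]; ring
  calc ENNReal.ofReal |(f * g) η - (f * g) ζ|
      ≤ ENNReal.ofReal (‖f‖ * |g η - g ζ| + ‖g‖ * |f η - f ζ|) := by
        refine ENNReal.ofReal_le_ofReal ?_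
        rw [h_leibniz]
        refine (abs_add_le _ _).trans ?_
        rw [abs_mul, abs_mul]
        gcongr
        · exact f.norm_coe_le_norm η
        · exact g.norm_coe_le_norm ζ
    _ = ENNReal.ofReal ‖f‖ * ENNReal.ofReal |g η - g ζ| +
        ENNReal.ofReal ‖g‖ * ENNReal.ofReal |f η - f ζ| := by
        rw [ENNReal.ofReal_add (by positivity) (by positivity),
          ENNReal.ofReal_mul (norm_nonneg _), ENNReal.ofReal_mul (norm_nonneg _)]
    _ ≤ _ := by
        gcongr
        · exact le_variation g h
        · exact le_variation f h

theorem tripleNorm_mul_le (f g : C(S → W, ℝ)) :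
    tripleNorm (f * g) ≤
      ENNReal.ofReal ‖f‖ * tripleNorm g + ENNReal.ofReal ‖g‖ * tripleNorm f := by
  simp only [tripleNorm, ← ENNReal.tsum_mul_left, ← ENNReal.tsum_add]
  exact ENNReal.tsum_le_tsum fun x => variation_mul_le f g x

theorem tripleNorm_le_card_mul_add_tsum (f : C(S → W, ℝ)) (F : Finset S) :
    tripleNorm f ≤
      F.card * ENNReal.ofReal (2 * ‖f‖) + ∑' x : {x // x ∉ F}, variation f x := by
  rw [tripleNorm, ← ENNReal.sum_add_tsum_compl F]
  gcongr
  · rw [← nsmul_eq_mul]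
    exact Finset.sum_le_card_nsmul F _ _ fun x _ => variation_le_norm f x
  · exact le_rfl

theorem tripleNorm_sub_le_card_mul_add_tsum {f : C(S → W, ℝ)} {a b : S → ℝ≥0∞}
    (hf : ∀ x, variation f x ≤ a x + b x) (g : C(S → W, ℝ)) (F : Finset S) :
    tripleNorm (f - g) ≤ F.card * ENNReal.ofReal (2 * ‖f - g‖) +
      (∑' x : {x // x ∉ F}, (a x + variation g x) + ∑' x, b x) := by
  have h_outside (x : S) : variation (f - g) x ≤ (a x + variation g x) + b x := by
    refine (variation_sub_le f g x).trans ((add_le_add_left (hf x) _).trans_eq ?_)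
    ring
  refine (tripleNorm_le_card_mul_add_tsum (f - g) F).trans (add_le_add_right ?_ _)
  calc ∑' x : {x // x ∉ F}, variation (f - g) x
      ≤ ∑' x : {x // x ∉ F}, ((a x + variation g x) + b x) :=
        ENNReal.tsum_le_tsum fun x => h_outside x
    _ = ∑' x : {x // x ∉ F}, (a x + variation g x) + ∑' x : {x // x ∉ F}, b x :=
        ENNReal.tsum_add
    _ ≤ ∑' x : {x // x ∉ F}, (a x + variation g x) + ∑' x, b x := by
        gcongr
        exact ENNReal.tsum_comp_le_tsum_of_injective Subtype.val_injective _

end Variation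

end IPS

theorem exists_lipschitzOnWith_of_contDiffOn {φ : ℝ → ℝ} {U K : Set ℝ} (hU : IsOpen U)
    (hφ : ContDiffOn ℝ 1 φ U) (hK : IsCompact K) (hKU : K ⊆ U) :
    ∃ L : ℝ≥0, LipschitzOnWith L φ K := by
  refine LocallyLipschitzOn.exists_lipschitzOnWith_of_compact hK fun x hx => ?_
  obtain ⟨L, t, ht, hL⟩ := ((hφ x (hKU hx)).contDiffAt
    (hU.mem_nhds (hKU hx))).exists_lipschitzOnWith
  exact ⟨L, t, mem_nhdsWithin_of_mem_nhds ht, hL⟩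

theorem lipschitzOnWith_exp (R : ℝ) :
    LipschitzOnWith (Real.exp R).toNNReal Real.exp (Iic R) := by
  refine (convex_Iic R).lipschitzOnWith_of_nnnorm_deriv_le
    (fun x _ => Real.differentiableAt_exp) fun x hx => ?_
  rw [Real.deriv_exp, ← NNReal.coe_le_coe, coe_nnnorm, Real.norm_of_nonneg (Real.exp_pos x).le,
    Real.coe_toNNReal _ (Real.exp_pos R).le]
  exact Real.exp_le_exp.2 hx

theorem exists_lipschitzOnWith_log {a : ℝ} (ha : 0 < a) (b : ℝ) :
    ∃ L : ℝ≥0, LipschitzOnWith L Real.log (Icc a b) :=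
  exists_lipschitzOnWith_of_contDiffOn isOpen_compl_singleton Real.contDiffOn_log isCompact_Icc
    fun _ hx => (ha.trans_le hx.1).ne'

namespace IPS

namespace TestSpace

variable {W S : Type*} [TopologicalSpace W] [CompactSpace W]

theorem tripleNorm_lt_top (f : TestSpace W S) : tripleNorm (incl W S f) < ⊤ := f.2

/-- An element of `C(E)` with finite triple norm, as an element of the space `D`. -/
def ofFinite (f : C(S → W, ℝ)) (hf : tripleNorm f < ⊤) : TestSpace W S := ⟨f, hf⟩

@[simp] theorem incl_ofFinite (f : C(S → W, ℝ)) (hf : tripleNorm f < ⊤) :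
    incl W S (ofFinite f hf) = f := rfl

theorem incl_injective : Function.Injective (incl W S) := Subtype.val_injective

theorem norm_def (f : TestSpace W S) :
    ‖f‖ = (tripleNorm (incl W S f)).toReal + ‖incl W S f‖ := rfl

theorem norm_incl_le (f : TestSpace W S) : ‖incl W S f‖ ≤ ‖f‖ :=
  le_add_of_nonneg_left ENNReal.toReal_nonneg

theorem toReal_tripleNorm_le (f : TestSpace W S) : (tripleNorm (incl W S f)).toReal ≤ ‖f‖ :=
  le_add_of_nonneg_right (norm_nonneg _)

theorem tripleNorm_le_ofReal_norm (f : TestSpace W S) :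
    tripleNorm (incl W S f) ≤ ENNReal.ofReal ‖f‖ :=
  (ENNReal.le_ofReal_iff_toReal_le (tripleNorm_lt_top f).ne (norm_nonneg f)).2
    (toReal_tripleNorm_le f)

theorem lipschitzWith_incl : LipschitzWith 1 (incl W S) :=
  AddMonoidHomClass.lipschitz_of_bound_nnnorm (incl W S) 1 fun f => by
    rw [one_mul]; exact norm_incl_le f

theorem continuous_incl : Continuous (incl W S) := lipschitzWith_incl.continuous

theorem tendsto_iff {ι : Type*} {l : Filter ι} {u : ι → TestSpace W S} {f : TestSpace W S} :
    Tendsto u l (𝓝 f) ↔ Tendsto (fun i => tripleNorm (incl W S (u i) - incl W S f)) l (𝓝 0) ∧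
      Tendsto (fun i => incl W S (u i)) l (𝓝 (incl W S f)) := by
  simp only [tendsto_iff_norm_sub_tendsto_zero (b := f), ← map_sub]
  constructor
  · intro h
    have h_ofReal := ENNReal.tendsto_ofReal h
    rw [ENNReal.ofReal_zero] at h_ofReal
    refine ⟨tendsto_of_tendsto_of_tendsto_of_le_of_le tendsto_const_nhds h_ofReal
      (fun _ => zero_le) fun i => tripleNorm_le_ofReal_norm _, ?_⟩
    exact (continuous_incl.tendsto f).comp (tendsto_iff_norm_sub_tendsto_zero.2 h)
  · rintro ⟨h_triple, h_sup⟩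
    have h_toReal := (ENNReal.tendsto_toReal ENNReal.zero_ne_top).comp h_triple
    rw [tendsto_iff_norm_sub_tendsto_zero] at h_sup
    simpa only [norm_def, map_sub, ENNReal.toReal_zero, add_zero, Function.comp_apply] using
      h_toReal.add h_sup

theorem tendsto_of_dominated {ι : Type*} {l : Filter ι} {u : ι → TestSpace W S}
    {f : TestSpace W S} {a : S → ℝ≥0∞} {b : ι → S → ℝ≥0∞}
    (h : Tendsto (fun i => incl W S (u i)) l (𝓝 (incl W S f)))
    (hab : ∀ᶠ i in l, ∀ x, variation (incl W S (u i)) x ≤ a x + b i x)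
    (ha : ∑' x, a x ≠ ⊤) (hb : Tendsto (fun i => ∑' x, b i x) l (𝓝 0)) :
    Tendsto u l (𝓝 f) := by
  refine tendsto_iff.2 ⟨ENNReal.tendsto_nhds_zero.2 fun ε hε => ?_, h⟩
  have h_sum : ∑' x, (a x + variation (incl W S f) x) ≠ ⊤ := by
    rw [ENNReal.tsum_add]
    exact ENNReal.add_ne_top.2 ⟨ha, (tripleNorm_lt_top f).ne⟩
  have hε3 : 0 < ε / 3 := ENNReal.div_pos hε.ne' (by simp)
  obtain ⟨F, hF⟩ := (ENNReal.tendsto_nhds_zero.1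
    (ENNReal.tendsto_tsum_compl_atTop_zero h_sum) _ hε3).exists
  have h_inside : Tendsto (fun i => (F.card : ℝ≥0∞) *
      ENNReal.ofReal (2 * ‖incl W S (u i) - incl W S f‖)) l (𝓝 0) := by
    have h_norm := ENNReal.tendsto_ofReal ((tendsto_iff_norm_sub_tendsto_zero.1 h).const_mul 2)
    simpa using ENNReal.Tendsto.const_mul (a := (F.card : ℝ≥0∞)) h_norm
      (Or.inr (ENNReal.natCast_ne_top _))
  filter_upwards [hab, ENNReal.tendsto_nhds_zero.1 hb _ hε3,
    ENNReal.tendsto_nhds_zero.1 h_inside _ hε3] with i hi_var hi_b hi_inside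
  calc tripleNorm (incl W S (u i) - incl W S f)
      ≤ ε / 3 + (ε / 3 + ε / 3) :=
        (tripleNorm_sub_le_card_mul_add_tsum hi_var _ F).trans
          (add_le_add hi_inside (add_le_add hF hi_b))
    _ = ε := by rw [← add_assoc, ENNReal.add_thirds]

theorem eventually_tripleNorm_sub_le_of_cauchySeq {u : ℕ → TestSpace W S} (hu : CauchySeq u)
    {f : C(S → W, ℝ)} (hf : Tendsto (fun n => incl W S (u n)) atTop (𝓝 f)) {ε : ℝ} (hε : 0 < ε) :
    ∀ᶠ n in atTop, tripleNorm (incl W S (u n) - f) ≤ ENNReal.ofReal ε := by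
  obtain ⟨N, hN⟩ := Metric.cauchySeq_iff.1 hu ε hε
  filter_upwards [eventually_ge_atTop N] with n hn
  have h_closed : IsClosed {g : C(S → W, ℝ) | tripleNorm g ≤ ENNReal.ofReal ε} :=
    lowerSemicontinuous_tripleNorm.isClosed_preimage _
  refine h_closed.mem_of_tendsto (hf.const_sub (incl W S (u n))) ?_
  filter_upwards [eventually_ge_atTop N] with m hm
  have h_dist := hN n hn m hm
  rw [dist_eq_norm] at h_dist
  rw [← map_sub]
  exact (tripleNorm_le_ofReal_norm _).trans (ENNReal.ofReal_le_ofReal h_dist.le)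

instance : CompleteSpace (TestSpace W S) := by
  refine Metric.complete_of_cauchySeq_tendsto fun u hu => ?_
  obtain ⟨f, hf⟩ := cauchySeq_tendsto_of_complete
    (lipschitzWith_incl.uniformContinuous.comp_cauchySeq hu)
  have h_near {ε : ℝ} (hε : 0 < ε) := eventually_tripleNorm_sub_le_of_cauchySeq hu hf hε
  have hf_finite : tripleNorm f < ⊤ := by
    obtain ⟨n, hn⟩ := (h_near one_pos).exists
    rw [tripleNorm_sub_comm] at hn
    have h_add := tripleNorm_add_le (f - incl W S (u n)) (incl W S (u n))
    rw [sub_add_cancel] at h_add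
    exact h_add.trans_lt (ENNReal.add_lt_top.2
      ⟨hn.trans_lt ENNReal.ofReal_lt_top, tripleNorm_lt_top _⟩)
  refine ⟨ofFinite f hf_finite, tendsto_iff.2 ⟨ENNReal.tendsto_nhds_zero.2 fun ε hε => ?_, hf⟩⟩
  obtain ⟨r, -, hr0, hrε⟩ := ENNReal.lt_iff_exists_real_btwn.1 hε
  exact (h_near (ENNReal.ofReal_pos.1 hr0)).mono fun n hn => hn.trans hrε.le

theorem tripleNorm_incl_mul_lt_top (f g : TestSpace W S) :
    tripleNorm (incl W S f * incl W S g) < ⊤ :=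
  (tripleNorm_mul_le _ _).trans_lt <| ENNReal.add_lt_top.2
    ⟨ENNReal.mul_lt_top ENNReal.ofReal_lt_top (tripleNorm_lt_top g),
      ENNReal.mul_lt_top ENNReal.ofReal_lt_top (tripleNorm_lt_top f)⟩

theorem toReal_tripleNorm_mul_le (f g : TestSpace W S) :
    (tripleNorm (incl W S f * incl W S g)).toReal ≤
      ‖incl W S f‖ * (tripleNorm (incl W S g)).toReal +
        ‖incl W S g‖ * (tripleNorm (incl W S f)).toReal := by
  have h_finite (f g : TestSpace W S) : ENNReal.ofReal ‖incl W S f‖ * tripleNorm (incl W S g) ≠ ⊤ :=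
    ENNReal.mul_ne_top ENNReal.ofReal_ne_top (tripleNorm_lt_top g).ne
  have h := ENNReal.toReal_mono (ENNReal.add_ne_top.2 ⟨h_finite f g, h_finite g f⟩)
    (tripleNorm_mul_le (incl W S f) (incl W S g))
  rwa [ENNReal.toReal_add (h_finite f g) (h_finite g f), ENNReal.toReal_mul, ENNReal.toReal_mul,
    ENNReal.toReal_ofReal (norm_nonneg _), ENNReal.toReal_ofReal (norm_nonneg _)] at h

variable (W S) in
/-- Multiplication in `D`, as a continuous bilinear map. -/
noncomputable def mulCLM : TestSpace W S →L[ℝ] TestSpace W S →L[ℝ] TestSpace W S :=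
  LinearMap.mkContinuous₂
    (LinearMap.mk₂ ℝ
      (fun f g => ofFinite (incl W S f * incl W S g) (tripleNorm_incl_mul_lt_top f g))
      (fun f f' g => incl_injective (by simp [add_mul]))
      (fun a f g => incl_injective (by simp))
      (fun f g g' => incl_injective (by simp [mul_add]))
      (fun a f g => incl_injective (by simp)))
    1 fun f g => by
      have h_triple := toReal_tripleNorm_mul_le f g
      have h_sup := norm_mul_le (incl W S f) (incl W S g)
      have h_cross : 0 ≤ (tripleNorm (incl W S f)).toReal * (tripleNorm (incl W S g)).toReal := by
        positivity
      simp only [LinearMap.mk₂_apply, norm_def, incl_ofFinite]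
      linarith

variable (W S) in
/-- The constant function `1`, as an element of `D`. -/
def one : TestSpace W S := ofFinite 1 (by simp [tripleNorm, variation])

/-- `φ ∘ f` as an element of `D`, for `φ` Lipschitz on the range of `f`. -/
noncomputable def lipschitzComp (φ : ℝ → ℝ) (f : TestSpace W S)
    (hφ : ∃ L : ℝ≥0, LipschitzOnWith L φ (range (incl W S f))) : TestSpace W S :=
  ofFinite
    ⟨fun η => φ (incl W S f η), hφ.choose_spec.continuousOn.comp_continuous
      (incl W S f).continuous fun η => mem_range_self η⟩ <|
    calc _ ≤ ∑' x, hφ.choose * variation (incl W S f) x :=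
          ENNReal.tsum_le_tsum fun x => variation_comp_le hφ.choose_spec (f := incl W S f)
            (fun η => mem_range_self η) (fun _ => rfl) x
      _ = hφ.choose * tripleNorm (incl W S f) := ENNReal.tsum_mul_left
      _ < ⊤ := ENNReal.mul_lt_top ENNReal.coe_lt_top (tripleNorm_lt_top f)

/-- The composition with `φ` need not be Lipschitz in `D`, because differences of variations are
not controlled; it is continuous by dominated convergence. -/
theorem tendsto_of_lipschitzOnWith {L : ℝ≥0} {φ : ℝ → ℝ} {K : Set ℝ} (hφ : LipschitzOnWith L φ K)
    {ι : Type*} {l : Filter ι} {u v : ι → TestSpace W S} {f g : TestSpace W S}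
    (hu : Tendsto u l (𝓝 f)) (huK : ∀ᶠ i in l, ∀ η, incl W S (u i) η ∈ K)
    (hfK : ∀ η, incl W S f η ∈ K) (hv : ∀ i η, incl W S (v i) η = φ (incl W S (u i) η))
    (hg : ∀ η, incl W S g η = φ (incl W S f η)) : Tendsto v l (𝓝 g) := by
  obtain ⟨hu_triple, hu_sup⟩ := tendsto_iff.1 hu
  refine tendsto_of_dominated (a := fun x => L * variation (incl W S f) x)
    (b := fun i x => L * variation (incl W S (u i) - incl W S f) x) ?_ ?_ ?_ ?_
  · rw [tendsto_iff_norm_sub_tendsto_zero] at hu_sup ⊢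
    refine squeeze_zero' (.of_forall fun i => norm_nonneg _) ?_
      (by simpa using hu_sup.const_mul (L : ℝ))
    filter_upwards [huK] with i hi
    refine (ContinuousMap.norm_le _ (by positivity)).2 fun η => ?_
    have h_lip := hφ.dist_le_mul _ (hi η) _ (hfK η)
    rw [← hv, ← hg, dist_eq_norm, dist_eq_norm] at h_lip
    refine h_lip.trans ?_
    gcongr
    exact (incl W S (u i) - incl W S f).norm_coe_le_norm η
  · filter_upwards [huK] with i hi x
    refine (variation_comp_le hφ hi (hv i) x).trans ?_
    rw [← mul_add]
    gcongr
    exact variation_le_add_sub _ _ x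
  · rw [ENNReal.tsum_mul_left]
    exact ENNReal.mul_ne_top ENNReal.coe_ne_top (tripleNorm_lt_top f).ne
  · simp_rw [ENNReal.tsum_mul_left]
    simpa [tripleNorm] using
      ENNReal.Tendsto.const_mul (a := (L : ℝ≥0∞)) hu_triple (Or.inr ENNReal.coe_ne_top)

theorem eventually_norm_incl_le (f : TestSpace W S) :
    ∀ᶠ g in 𝓝 f, ‖incl W S g‖ ≤ ‖incl W S f‖ + 1 :=
  ((continuous_incl.norm.tendsto f).eventually_lt_const (lt_add_one _)).mono fun _ h => h.le

theorem incl_apply_le_of_norm_le {f : TestSpace W S} {R : ℝ} (hf : ‖incl W S f‖ ≤ R)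
    (η : S → W) : incl W S f η ≤ R :=
  (le_abs_self _).trans (((incl W S f).norm_coe_le_norm η).trans hf)

/-- The map `f ↦ e^f` of `D` into itself. -/
noncomputable def exp (f : TestSpace W S) : TestSpace W S :=
  lipschitzComp Real.exp f ⟨_, (lipschitzOnWith_exp ‖incl W S f‖).mono <|
    range_subset_iff.2 <| incl_apply_le_of_norm_le le_rfl⟩

theorem continuous_exp : Continuous (exp : TestSpace W S → TestSpace W S) :=
  continuous_iff_continuousAt.2 fun f =>
    tendsto_of_lipschitzOnWith (lipschitzOnWith_exp (‖incl W S f‖ + 1)) tendsto_id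
      ((eventually_norm_incl_le f).mono fun _ hg => incl_apply_le_of_norm_le hg)
      (incl_apply_le_of_norm_le (lt_add_one _).le) (fun _ _ => rfl) fun _ => rfl

theorem toReal_tripleNorm_exp_le (f : TestSpace W S) :
    (tripleNorm (expFun (incl W S f))).toReal ≤
      Real.exp ‖incl W S f‖ * (tripleNorm (incl W S f)).toReal := by
  have h : tripleNorm (expFun (incl W S f)) ≤
      (Real.exp ‖incl W S f‖).toNNReal * tripleNorm (incl W S f) := by
    rw [tripleNorm, tripleNorm, ← ENNReal.tsum_mul_left]
    exact ENNReal.tsum_le_tsum <| variation_comp_le (lipschitzOnWith_exp ‖incl W S f‖)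
      (incl_apply_le_of_norm_le le_rfl) fun _ => rfl
  have h_real := ENNReal.toReal_mono
    (ENNReal.mul_ne_top ENNReal.coe_ne_top (tripleNorm_lt_top f).ne) h
  rwa [ENNReal.toReal_mul, ENNReal.coe_toReal, Real.coe_toNNReal _ (Real.exp_pos _).le] at h_real

end TestSpace

end IPS

namespace IsBarrel

theorem mem_nhds_zero {X : Type*} [AddCommGroup X] [Module ℝ X] [TopologicalSpace X]
    [ContinuousConstSMul ℝ X] [BarrelledSpace ℝ X] {B : Set X} (hB : IsBarrel B) :
    B ∈ 𝓝 (0 : X) := by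
  let p : Seminorm ℝ X := gaugeSeminorm hB.balanced hB.convex hB.absorbent
  have h_zero : (0 : X) ∈ B := hB.absorbent.zero_mem
  have hp : LowerSemicontinuous p := lowerSemicontinuous_iff_isClosed_preimage.2 fun a => by
    rcases lt_or_ge a 0 with ha | ha
    · convert isClosed_empty
      exact eq_empty_of_forall_notMem fun x hx => (ha.trans_le (apply_nonneg p x)).not_ge hx
    · change IsClosed {x | gauge B x ≤ a}
      rw [setOfPred_gauge_le_eq hB.convex h_zero hB.absorbent ha]
      exact isClosed_biInter fun r hr => hB.isClosed.smul_of_ne_zero (ha.trans_lt hr).ne'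
  have h_open : IsOpen {x | p x < 1} :=
    isOpen_lt (p.continuous_of_lowerSemicontinuous hp) continuous_const
  exact mem_of_superset (h_open.mem_nhds (by simp))
    (setOfPred_gauge_lt_one_subset_self hB.convex h_zero hB.absorbent)

theorem closedBall {X : Type*} [SeminormedAddCommGroup X] [NormedSpace ℝ X] {r : ℝ}
    (hr : 0 < r) : IsBarrel (Metric.closedBall (0 : X) r) where
  convex := convex_closedBall 0 r
  balanced := balanced_closedBall_zero
  absorbent := absorbent_nhds_zero (Metric.closedBall_mem_nhds 0 hr)
  isClosed := Metric.isClosed_closedBall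

end IsBarrel

namespace IPS

variable {W S : Type*}

section Modify

variable {Λ : Finset S} {x : S}

theorem modify_of_mem (hx : x ∈ Λ) (η : S → W) (ζ : Λ → W) : modify η ζ x = ζ ⟨x, hx⟩ :=
  dif_pos hx

theorem modify_of_notMem (hx : x ∉ Λ) (η : S → W) (ζ : Λ → W) : modify η ζ x = η x :=
  dif_neg hx

theorem continuous_uncurry_modify [TopologicalSpace W] (Λ : Finset S) :
    Continuous fun p : (S → W) × (Λ → W) => modify p.1 p.2 := by
  refine continuous_pi fun x => ?_
  by_cases h : x ∈ Λ
  · simp only [modify_of_mem h]; fun_prop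
  · simp only [modify_of_notMem h]; fun_prop

theorem IsVariationBound.abs_modify_sub_modify_le [TopologicalSpace W] {f : C(S → W, ℝ)}
    {b : S → ℝ} (hf : IsVariationBound f b) {η η' : S → W} (h : ∀ y, y ≠ x → η y = η' y)
    (ζ : Λ → W) :
    |f (modify η ζ) - f (modify η' ζ)| ≤ b x := by
  refine hf x _ _ fun y hy => ?_
  by_cases hyΛ : y ∈ Λ
  · rw [modify_of_mem hyΛ, modify_of_mem hyΛ]
  · rw [modify_of_notMem hyΛ, modify_of_notMem hyΛ, h y hy]

end Modify

section Cylinder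

variable [TopologicalSpace W]

/-- A function of the coordinates in `F`, as a function on `E`. -/
def cylinder (F : Finset S) (h : C(F → W, ℝ)) : C(S → W, ℝ) :=
  h.comp ⟨F.restrict, Pi.continuous_domRestrict _⟩

theorem cylinder_apply (F : Finset S) (h : C(F → W, ℝ)) (η : S → W) :
    cylinder F h η = h (F.restrict η) := rfl

theorem variation_cylinder_of_notMem {F : Finset S} {x : S} (hx : x ∉ F) (h : C(F → W, ℝ)) :
    variation (cylinder F h) x = 0 := by
  refine le_antisymm (variation_le_iff.2 fun η ζ hηζ => ?_) zero_le
  have h_restrict : F.restrict η = F.restrict ζ :=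
    funext fun y => hηζ y (ne_of_mem_of_not_mem y.2 hx)
  simp [cylinder_apply, h_restrict]

variable [CompactSpace W]

theorem norm_cylinder_le (F : Finset S) (h : C(F → W, ℝ)) : ‖cylinder F h‖ ≤ ‖h‖ :=
  (ContinuousMap.norm_le _ (norm_nonneg _)).2 fun _ => h.norm_coe_le_norm _

theorem tripleNorm_cylinder_le (F : Finset S) (h : C(F → W, ℝ)) :
    tripleNorm (cylinder F h) ≤ F.card * ENNReal.ofReal (2 * ‖h‖) := by
  rw [tripleNorm, tsum_eq_sum fun x hx => variation_cylinder_of_notMem hx h, ← nsmul_eq_mul]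
  refine Finset.sum_le_card_nsmul _ _ _ fun x _ => (variation_le_norm _ x).trans ?_
  gcongr
  exact norm_cylinder_le F h

namespace TestSpace

/-- The map `cylinder F`, as a continuous linear map into the space `D`. -/
noncomputable def cylinderCLM (F : Finset S) : C(F → W, ℝ) →L[ℝ] TestSpace W S :=
  LinearMap.mkContinuous
    { toFun := fun h => ofFinite (cylinder F h) <| (tripleNorm_cylinder_le F h).trans_lt <|
        ENNReal.mul_lt_top (ENNReal.natCast_lt_top _) ENNReal.ofReal_lt_top
      map_add' := fun _ _ => rfl
      map_smul' := fun _ _ => rfl }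
    (F.card * 2 + 1) fun h => by
      have h_triple := ENNReal.toReal_mono
        (ENNReal.mul_ne_top (ENNReal.natCast_ne_top _) ENNReal.ofReal_ne_top)
        (tripleNorm_cylinder_le F h)
      rw [ENNReal.toReal_mul, ENNReal.toReal_natCast, ENNReal.toReal_ofReal (by positivity)]
        at h_triple
      change (tripleNorm (cylinder F h)).toReal + ‖cylinder F h‖ ≤ _
      linarith [norm_cylinder_le F h]

/-- The cylinder function `η ↦ f(η_F o_{Fᶜ})`: the coordinates off `F` are frozen to those of
`o`. -/
noncomputable def truncate (o : S → W) (F : Finset S) (f : C(S → W, ℝ)) : TestSpace W S :=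
  cylinderCLM F ⟨fun ζ => f (modify o ζ), f.continuous.comp <|
    (continuous_uncurry_modify F).comp (Continuous.prodMk_right o)⟩

theorem incl_truncate_apply (o : S → W) (F : Finset S) (f : C(S → W, ℝ)) (η : S → W) :
    incl W S (truncate o F f) η = f (modify o (F.restrict η)) := rfl

theorem variation_truncate_le (o : S → W) (F : Finset S) (f : C(S → W, ℝ)) (x : S) :
    variation (incl W S (truncate o F f)) x ≤ variation f x := by
  refine variation_le_iff.2 fun η ζ h => ?_
  simp only [incl_truncate_apply]
  refine le_variation f fun y hy => ?_
  by_cases hyF : y ∈ F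
  · simp only [modify_of_mem hyF, Finset.restrict, h y hy]
  · simp only [modify_of_notMem hyF]

end TestSpace

end Cylinder

open TestSpace

section Uniform

variable [UniformSpace W]

theorem tendstoUniformly_modify_restrict (o : S → W) :
    TendstoUniformly (fun (F : Finset S) (η : S → W) => modify o (F.restrict η)) id atTop := by
  rw [tendstoUniformly_iff_tendsto, Pi.uniformity, tendsto_iInf]
  intro x
  rw [tendsto_comap_iff]
  refine tendsto_def.2 fun V hV => ?_
  have h_mem : ∀ᶠ F : Finset S in atTop, x ∈ F :=
    (eventually_ge_atTop {x}).mono fun F hF => hF (Finset.mem_singleton_self x)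
  filter_upwards [h_mem.prod_inl (⊤ : Filter (S → W))] with p hp
  simp only [mem_preimage, Function.comp, id, modify_of_mem hp]
  exact refl_mem_uniformity hV

variable [CompactSpace W]

theorem tendsto_incl_truncate (o : S → W) (f : C(S → W, ℝ)) :
    Tendsto (fun F => incl W S (truncate o F f)) atTop (𝓝 f) :=
  ContinuousMap.tendsto_iff_tendstoUniformly.2 <|
    (CompactSpace.uniformContinuous_of_continuous f.continuous).comp_tendstoUniformly
      (tendstoUniformly_modify_restrict o)

theorem denseRange_incl : DenseRange (incl W S) := by
  intro f
  obtain _ | ⟨⟨o⟩⟩ := isEmpty_or_nonempty (S → W)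
  · rw [show f = incl W S 0 from ContinuousMap.ext isEmptyElim]
    exact subset_closure (mem_range_self _)
  · exact mem_closure_of_tendsto (tendsto_incl_truncate o f)
      (.of_forall fun F => mem_range_self _)

theorem TestSpace.tendsto_truncate (o : S → W) (f : TestSpace W S) :
    Tendsto (fun F => truncate o F (incl W S f)) atTop (𝓝 f) :=
  tendsto_of_dominated (a := variation (incl W S f)) (b := fun _ _ => 0)
    (tendsto_incl_truncate o (incl W S f))
    (.of_forall fun F x => by simpa using variation_truncate_le o F (incl W S f) x)
    (tripleNorm_lt_top f).ne (by simp)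

end Uniform

instance TestSpace.separableSpace [MetricSpace W] [CompactSpace W] [Countable S] :
    TopologicalSpace.SeparableSpace (TestSpace W S) := by
  obtain _ | ⟨⟨o⟩⟩ := isEmpty_or_nonempty (S → W)
  · have : Subsingleton (TestSpace W S) :=
      ⟨fun f g => incl_injective (ContinuousMap.ext isEmptyElim)⟩
    infer_instance
  have h_separable : TopologicalSpace.IsSeparable
      (⋃ F : Finset S, range (cylinderCLM (W := W) F)) :=
    .iUnion fun F => TopologicalSpace.isSeparable_range (cylinderCLM F).continuous
  rw [← TopologicalSpace.isSeparable_univ_iff]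
  refine h_separable.closure.mono fun f _ => ?_
  exact mem_closure_of_tendsto (tendsto_truncate o f)
    (.of_forall fun F => mem_iUnion.2 ⟨F, mem_range_self _⟩)

end IPS

section TotalVariation

variable {α : Type*} [MeasurableSpace α] (μ ν : Measure α) [IsFiniteMeasure μ] [IsFiniteMeasure ν]

theorem totalVariation_toSignedMeasure_sub :
    (μ.toSignedMeasure - ν.toSignedMeasure).totalVariation = (μ - ν) + (ν - μ) := by
  rw [SignedMeasure.totalVariation, Measure.toJordanDecomposition_toSignedMeasure_sub,
    Measure.jordanDecompositionOfToSignedMeasureSub_posPart,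
    Measure.jordanDecompositionOfToSignedMeasureSub_negPart]

theorem totalVariation_toSignedMeasure_sub_le :
    (μ.toSignedMeasure - ν.toSignedMeasure).totalVariation ≤ μ + ν := by
  rw [totalVariation_toSignedMeasure_sub]
  exact add_le_add Measure.sub_le Measure.sub_le

theorem measure_add_sub_comm : μ + (ν - μ) = ν + (μ - ν) := by
  rw [← Measure.toSignedMeasure_eq_toSignedMeasure_iff, Measure.toSignedMeasure_add,
    Measure.toSignedMeasure_add, add_comm ν.toSignedMeasure, ← sub_eq_sub_iff_add_eq_add]
  exact Measure.sub_toSignedMeasure_eq_toSignedMeasure_sub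

variable {μ ν}

theorem abs_integral_sub_integral_le {g : α → ℝ} (hg : StronglyMeasurable g) {C : ℝ}
    (hC : ∀ x, |g x| ≤ C) :
    |∫ x, g x ∂μ - ∫ x, g x ∂ν| ≤
      C * ((μ.toSignedMeasure - ν.toSignedMeasure).totalVariation univ).toReal := by
  have h_integrable (ρ : Measure α) [IsFiniteMeasure ρ] : Integrable g ρ :=
    .of_bound hg.aestronglyMeasurable C (.of_forall hC)
  have h_integral : ∫ x, g x ∂μ + ∫ x, g x ∂(ν - μ) = ∫ x, g x ∂ν + ∫ x, g x ∂(μ - ν) := by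
    rw [← integral_add_measure (h_integrable _) (h_integrable _), measure_add_sub_comm,
      integral_add_measure (h_integrable _) (h_integrable _)]
  have h_le (ρ : Measure α) [IsFiniteMeasure ρ] : |∫ x, g x ∂ρ| ≤ C * (ρ univ).toReal :=
    norm_integral_le_of_norm_le_const (f := g) (.of_forall hC)
  rw [totalVariation_toSignedMeasure_sub, Measure.add_apply,
    ENNReal.toReal_add (measure_ne_top _ _) (measure_ne_top _ _), mul_add]
  calc |∫ x, g x ∂μ - ∫ x, g x ∂ν| = |∫ x, g x ∂(μ - ν) - ∫ x, g x ∂(ν - μ)| := by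
        congr 1; linarith
    _ ≤ |∫ x, g x ∂(μ - ν)| + |∫ x, g x ∂(ν - μ)| := abs_sub _ _
    _ ≤ _ := add_le_add (h_le _) (h_le _)

end TotalVariation

namespace IPS

section Kernel

variable {S : Type*}

/-- The action on functions of a kernel `K` on a set of sites, `K a (x) = ∑_y K(x, y) a(y)`. -/
noncomputable def kernelApply (K : S → S → ℝ≥0∞) (a : S → ℝ≥0∞) (x : S) : ℝ≥0∞ :=
  ∑' y, K x y * a y

variable {K : S → S → ℝ≥0∞} {C κ : ℝ≥0∞}

theorem kernelApply_const_mul (r : ℝ≥0∞) (a : S → ℝ≥0∞) (x : S) :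
    kernelApply K (fun y => r * a y) x = r * kernelApply K a x := by
  simp only [kernelApply, ← ENNReal.tsum_mul_left, mul_left_comm]

theorem kernelApply_tsum {ι : Type*} (a : ι → S → ℝ≥0∞) (x : S) :
    kernelApply K (fun y => ∑' i, a i y) x = ∑' i, kernelApply K (a i) x := by
  simp only [kernelApply, ← ENNReal.tsum_mul_left]
  exact ENNReal.tsum_comm

theorem tsum_kernelApply_le (hK : ∀ y, ∑' x, K x y ≤ C) (a : S → ℝ≥0∞) :
    ∑' x, kernelApply K a x ≤ C * ∑' y, a y := by
  simp only [kernelApply]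
  rw [ENNReal.tsum_comm, ← ENNReal.tsum_mul_left]
  refine ENNReal.tsum_le_tsum fun y => ?_
  rw [ENNReal.tsum_mul_right]
  gcongr
  exact hK y

theorem tsum_iterate_kernelApply_le (hK : ∀ y, ∑' x, K x y ≤ C) (a : S → ℝ≥0∞) (n : ℕ) :
    ∑' x, ((kernelApply K)^[n] a) x ≤ C ^ n * ∑' x, a x := by
  induction n with
  | zero => simp
  | succ n ih =>
    rw [Function.iterate_succ_apply', pow_succ', mul_assoc]
    exact (tsum_kernelApply_le hK _).trans (by gcongr)

/-- The Neumann series `∑ₙ κ⁻ⁿ Kⁿ a`, which is a majorant of `a` whose image under `K` is at most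
`κ` times itself. -/
noncomputable def neumannSeries (K : S → S → ℝ≥0∞) (κ : ℝ≥0∞) (a : S → ℝ≥0∞) (x : S) : ℝ≥0∞ :=
  ∑' n : ℕ, κ⁻¹ ^ n * ((kernelApply K)^[n] a) x

theorem le_neumannSeries (a : S → ℝ≥0∞) : a ≤ neumannSeries K κ a := fun x => by
  simpa only [neumannSeries, pow_zero, one_mul, Function.iterate_zero_apply] using
    ENNReal.le_tsum (f := fun n : ℕ => κ⁻¹ ^ n * ((kernelApply K)^[n] a) x) 0

theorem tsum_neumannSeries_le (hK : ∀ y, ∑' x, K x y ≤ C) (a : S → ℝ≥0∞) :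
    ∑' x, neumannSeries K κ a x ≤ (1 - κ⁻¹ * C)⁻¹ * ∑' x, a x := by
  simp only [neumannSeries]
  rw [ENNReal.tsum_comm, ← ENNReal.tsum_geometric, ← ENNReal.tsum_mul_right]
  refine ENNReal.tsum_le_tsum fun n => ?_
  rw [ENNReal.tsum_mul_left, mul_pow, mul_assoc]
  gcongr
  exact tsum_iterate_kernelApply_le hK a n

theorem kernelApply_neumannSeries_le (hκ : κ ≠ 0) (hκ' : κ ≠ ⊤) (a : S → ℝ≥0∞) (x : S) :
    kernelApply K (neumannSeries K κ a) x ≤ κ * neumannSeries K κ a x := by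
  have h_shift (n : ℕ) : kernelApply K (fun y => κ⁻¹ ^ n * ((kernelApply K)^[n] a) y) x =
      κ * (κ⁻¹ ^ (n + 1) * ((kernelApply K)^[n + 1] a) x) := by
    rw [kernelApply_const_mul, Function.iterate_succ_apply', pow_succ', mul_assoc,
      ENNReal.mul_inv_cancel_left hκ hκ']
  calc kernelApply K (neumannSeries K κ a) x
      = κ * ∑' n : ℕ, κ⁻¹ ^ (n + 1) * ((kernelApply K)^[n + 1] a) x := by
        rw [← ENNReal.tsum_mul_left, ← tsum_congr h_shift]
        exact kernelApply_tsum (fun (n : ℕ) y => κ⁻¹ ^ n * ((kernelApply K)^[n] a) y) x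
    _ ≤ κ * neumannSeries K κ a x := by
        gcongr
        exact ENNReal.tsum_comp_le_tsum_of_injective (add_left_injective 1)
          fun n : ℕ => κ⁻¹ ^ n * ((kernelApply K)^[n] a) x

theorem exists_le_kernelApply_le (hC : C ≠ ⊤) (hK : ∀ y, ∑' x, K x y ≤ C) (a : S → ℝ≥0∞) :
    ∃ b : S → ℝ≥0∞, a ≤ b ∧ ∑' x, b x ≤ 2 * ∑' x, a x ∧
      ∀ x, kernelApply K b x ≤ (2 * C + 1) * b x := by
  refine ⟨neumannSeries K (2 * C + 1) a, le_neumannSeries a,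
    (tsum_neumannSeries_le hK a).trans ?_,
    kernelApply_neumannSeries_le (by simp) (by finiteness) a⟩
  have h_ratio : (2 * C + 1)⁻¹ * C ≤ 2⁻¹ := by
    rw [mul_comm, ← div_eq_mul_inv]
    refine ENNReal.div_le_of_le_mul ?_
    rw [mul_add, ENNReal.inv_mul_cancel_left (by simp) (by simp)]
    exact le_self_add
  gcongr
  rw [ENNReal.inv_le_iff_inv_le, ← ENNReal.one_sub_inv_two]
  gcongr

theorem tsum_eq_add_tsum_ne (g : S → ℝ≥0∞) (y : S) :
    ∑' x, g x = g y + ∑' u : {u : S // u ≠ y}, g u := by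
  rw [← ENNReal.summable.tsum_add_tsum_compl (s := {y}) ENNReal.summable, tsum_singleton y g]
  rfl

theorem tsum_mul_sum_eq (r : Finset S → ℝ≥0∞) (a : S → ℝ≥0∞) :
    ∑' Λ : Finset S, r Λ * ∑ y ∈ Λ, a y = ∑' y, (∑' Λ : {Λ : Finset S // y ∈ Λ}, r Λ) * a y := by
  classical
  have h_left (Λ : Finset S) : r Λ * ∑ y ∈ Λ, a y = ∑' y, if y ∈ Λ then r Λ * a y else 0 := by
    rw [tsum_eq_sum (s := Λ) fun y hy => if_neg hy, Finset.mul_sum]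
    exact Finset.sum_congr rfl fun y hy => (if_pos hy).symm
  have h_right (y : S) : (∑' Λ : {Λ : Finset S // y ∈ Λ}, r Λ) * a y =
      ∑' Λ : Finset S, if y ∈ Λ then r Λ * a y else 0 := by
    rw [← ENNReal.tsum_mul_right]
    exact (tsum_subtype {Λ : Finset S | y ∈ Λ} fun Λ => r Λ * a y).trans
      (tsum_congr fun Λ => by simp only [indicator_apply, mem_ofPred_eq])
  simp_rw [h_left, h_right]
  exact ENNReal.tsum_comm

theorem tsum_mul_sum_le {r : Finset S → ℝ≥0∞}
    (h : ∀ y, ∑' Λ : {Λ : Finset S // y ∈ Λ}, r Λ ≤ C) (a : S → ℝ≥0∞) :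
    ∑' Λ : Finset S, r Λ * ∑ y ∈ Λ, a y ≤ C * ∑' y, a y := by
  rw [tsum_mul_sum_eq, ← ENNReal.tsum_mul_left]
  exact ENNReal.tsum_le_tsum fun y => by gcongr; exact h y

end Kernel

end IPS

theorem continuous_integral_finiteMeasure {Y : Type*} [TopologicalSpace Y] [CompactSpace Y]
    [MeasurableSpace Y] [OpensMeasurableSpace Y] :
    Continuous fun p : C(Y, ℝ) × FiniteMeasure Y => ∫ y, p.1 y ∂(p.2 : Measure Y) := by
  refine continuous_iff_continuousAt.2 fun ⟨f₀, μ₀⟩ => ?_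
  have h_integrable (f : C(Y, ℝ)) (μ : FiniteMeasure Y) : Integrable f (μ : Measure Y) :=
    f.continuous.integrable_of_hasCompactSupport (.of_compactSpace _)
  have h_measure : Tendsto (fun p : C(Y, ℝ) × FiniteMeasure Y => ∫ y, f₀ y ∂(p.2 : Measure Y))
      (𝓝 (f₀, μ₀)) (𝓝 (∫ y, f₀ y ∂(μ₀ : Measure Y))) :=
    FiniteMeasure.tendsto_iff_forall_integral_tendsto.1 (continuous_snd.tendsto (f₀, μ₀))
      (BoundedContinuousFunction.mkOfCompact f₀)
  have h_bound : Tendsto (fun p : C(Y, ℝ) × FiniteMeasure Y => ‖p.1 - f₀‖ * p.2.mass)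
      (𝓝 (f₀, μ₀)) (𝓝 0) := by
    have h_cont : Continuous fun p : C(Y, ℝ) × FiniteMeasure Y => ‖p.1 - f₀‖ * (p.2.mass : ℝ) :=
      (continuous_fst.sub continuous_const).norm.mul
        (NNReal.continuous_coe.comp (FiniteMeasure.continuous_mass.comp continuous_snd))
    simpa only [sub_self, norm_zero, zero_mul] using h_cont.tendsto (f₀, μ₀)
  have h_function : Tendsto
      (fun p : C(Y, ℝ) × FiniteMeasure Y => ∫ y, (p.1 - f₀) y ∂(p.2 : Measure Y))
      (𝓝 (f₀, μ₀)) (𝓝 0) :=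
    squeeze_zero_norm (fun p => norm_integral_le_of_norm_le_const
      (.of_forall (p.1 - f₀).norm_coe_le_norm)) h_bound
  refine (zero_add (∫ y, f₀ y ∂(μ₀ : Measure Y)) ▸ h_function.add h_measure).congr fun p => ?_
  rw [← integral_add (h_integrable _ _) (h_integrable _ _)]
  simp only [ContinuousMap.sub_apply, sub_add_cancel]

namespace IPS

variable {W S : Type*} [MetricSpace W] [CompactSpace W] [MeasurableSpace W] [BorelSpace W]

section MaximalRates

variable (c : Rates W S) (Λ : Finset S)

theorem maxRate_lt_top : maxRate c Λ < ⊤ := by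
  have h_cont : Continuous fun η => (c Λ η).mass :=
    FiniteMeasure.continuous_mass.comp (c Λ).continuous
  obtain ⟨C, hC⟩ := (isCompact_range h_cont).bddAbove
  refine (iSup_le fun η => ?_).trans_lt (ENNReal.coe_lt_top (r := C))
  rw [← FiniteMeasure.ennreal_mass]
  exact ENNReal.coe_le_coe.2 (hC (mem_range_self η))

/-- `c_Λ` as a real number. -/
noncomputable def rate : ℝ≥0 := (maxRate c Λ).toNNReal

theorem coe_rate : (rate c Λ : ℝ≥0∞) = maxRate c Λ :=
  ENNReal.coe_toNNReal (maxRate_lt_top c Λ).ne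

theorem measure_univ_le_maxRate (η : S → W) : (c Λ η : Measure (Λ → W)) univ ≤ maxRate c Λ :=
  le_iSup (fun η => (c Λ η : Measure (Λ → W)) univ) η

theorem measureReal_le_rate (η : S → W) : (c Λ η : Measure (Λ → W)).real univ ≤ rate c Λ :=
  ENNReal.toReal_mono (maxRate_lt_top c Λ).ne (measure_univ_le_maxRate c Λ η)

theorem totalVariation_le_rateDependence {x : S} {η η' : S → W} (h : ∀ y, y ≠ x → η y = η' y) :
    ((c Λ η : Measure (Λ → W)).toSignedMeasure -
      (c Λ η' : Measure (Λ → W)).toSignedMeasure).totalVariation univ ≤ rateDependence c Λ x :=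
  le_iSup_of_le η <| le_iSup_of_le η' <| le_iSup_of_le h le_rfl

theorem rateDependence_le (x : S) : rateDependence c Λ x ≤ 2 * maxRate c Λ := by
  refine iSup_le fun η => iSup_le fun η' => iSup_le fun _ => ?_
  calc _ ≤ (c Λ η : Measure (Λ → W)) univ + (c Λ η' : Measure (Λ → W)) univ :=
        totalVariation_toSignedMeasure_sub_le _ _ univ
    _ ≤ 2 * maxRate c Λ := by
        rw [two_mul]
        exact add_le_add (measure_univ_le_maxRate c Λ η) (measure_univ_le_maxRate c Λ η')

theorem rateDependence_ne_top (x : S) : rateDependence c Λ x ≠ ⊤ :=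
  ((rateDependence_le c Λ x).trans_lt
    (ENNReal.mul_lt_top (by simp) (maxRate_lt_top c Λ))).ne

end MaximalRates

section JumpOperator

theorem continuous_jumpTerm (c : Rates W S) (f : C(S → W, ℝ)) (Λ : Finset S) :
    Continuous fun η => jumpTerm c f η Λ := by
  let increment : C((S → W) × (Λ → W), ℝ) :=
    ⟨fun p => f (modify p.1 p.2) - f p.1,
      (f.continuous.comp (continuous_uncurry_modify Λ)).sub (f.continuous.comp continuous_fst)⟩
  exact continuous_integral_finiteMeasure.comp
    (increment.curry.continuous.prodMk (c Λ).continuous)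

theorem abs_jumpTerm_le (c : Rates W S) {f : C(S → W, ℝ)} {Λ : Finset S} {C : ℝ}
    (hC : ∀ η ζ : S → W, (∀ y, y ∉ Λ → η y = ζ y) → |f η - f ζ| ≤ C) (η : S → W) :
    |jumpTerm c f η Λ| ≤ rate c Λ * C := by
  have hC0 : 0 ≤ C := (abs_nonneg _).trans (hC η η fun _ _ => rfl)
  have h_increment (ζ : Λ → W) : ‖f (modify η ζ) - f η‖ ≤ C :=
    hC _ _ fun y hy => modify_of_notMem hy η ζ
  refine (norm_integral_le_of_norm_le_const (.of_forall h_increment)).trans ?_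
  rw [mul_comm]
  gcongr
  exact measureReal_le_rate c Λ η

/-- The operator `f ↦ ∫ c_Λ(·, dζ) [f(·^ζ) - f(·)]` in `C(E)`. -/
noncomputable def jump (c : Rates W S) (Λ : Finset S) : C(S → W, ℝ) →L[ℝ] C(S → W, ℝ) :=
  LinearMap.mkContinuous
    { toFun := fun f => ⟨fun η => jumpTerm c f η Λ, continuous_jumpTerm c f Λ⟩
      map_add' := fun f f' => by
        ext η
        simp only [ContinuousMap.coe_mk, ContinuousMap.add_apply, jumpTerm, add_sub_add_comm]
        exact integral_add (integrable_jump c f η Λ) (integrable_jump c f' η Λ)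
      map_smul' := fun a f => by
        ext η
        simp only [ContinuousMap.coe_mk, ContinuousMap.smul_apply, jumpTerm, RingHom.id_apply,
          ← smul_sub]
        exact integral_smul a _ }
    (rate c Λ * 2) fun f => by
      refine (ContinuousMap.norm_le _ (by positivity)).2 fun η => ?_
      rw [mul_assoc]
      refine abs_jumpTerm_le c (fun η ζ _ => (abs_sub _ _).trans ?_) η
      rw [two_mul]
      exact add_le_add (f.norm_coe_le_norm η) (f.norm_coe_le_norm ζ)

theorem jump_apply (c : Rates W S) (Λ : Finset S) (f : C(S → W, ℝ)) (η : S → W) :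
    jump c Λ f η = jumpTerm c f η Λ := rfl

theorem jump_apply_eq_integral_sub (c : Rates W S) (Λ : Finset S) (f : C(S → W, ℝ))
    (η : S → W) : jump c Λ f η = ∫ ζ : Λ → W, f (modify η ζ) ∂(c Λ η : Measure (Λ → W)) -
      (c Λ η : Measure (Λ → W)).real univ * f η := by
  have h_integrable : Integrable (fun ζ : Λ → W => f (modify η ζ)) (c Λ η : Measure (Λ → W)) :=
    (f.continuous.comp (continuous_modify η)).integrable_of_hasCompactSupport
      (.of_compactSpace _)
  rw [jump_apply, jumpTerm, integral_sub h_integrable (integrable_const _), integral_const,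
    smul_eq_mul]

theorem jump_one (c : Rates W S) (Λ : Finset S) : jump c Λ 1 = 0 := by
  ext η
  simp [jump_apply, jumpTerm]

theorem neg_le_jump (c : Rates W S) (Λ : Finset S) {f : C(S → W, ℝ)} (hf : 0 ≤ f) (η : S → W) :
    -(rate c Λ * f η) ≤ jump c Λ f η := by
  have h_integral : 0 ≤ ∫ ζ : Λ → W, f (modify η ζ) ∂(c Λ η : Measure (Λ → W)) :=
    integral_nonneg fun ζ => hf (modify η ζ)
  have h_mass : (c Λ η : Measure (Λ → W)).real univ * f η ≤ rate c Λ * f η :=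
    mul_le_mul_of_nonneg_right (measureReal_le_rate c Λ η) (hf η)
  rw [jump_apply_eq_integral_sub]
  linarith

variable {f : C(S → W, ℝ)} {b : S → ℝ}

theorem norm_jump_le (c : Rates W S) (Λ : Finset S) (hf : IsVariationBound f b)
    (hb : ∀ x, 0 ≤ b x) : ‖jump c Λ f‖ ≤ rate c Λ * ∑ y ∈ Λ, b y :=
  (ContinuousMap.norm_le _ (mul_nonneg (rate c Λ).2 (Finset.sum_nonneg fun y _ => hb y))).2
    fun η => abs_jumpTerm_le c (fun _ _ h => hf.abs_sub_le_sum Λ h) η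

/-- The loss term `c_Λ(η, W^Λ) f` of the jump operator is moved to the left-hand side, so that it
can be absorbed by the identity in a discrete time step of the dynamics. -/
theorem abs_jump_sub_jump_add_le (c : Rates W S) (Λ : Finset S) (hf : IsVariationBound f b)
    (hb : ∀ x, 0 ≤ b x) {x : S} {η η' : S → W} (h : ∀ y, y ≠ x → η y = η' y) :
    |jump c Λ f η - jump c Λ f η' + (c Λ η : Measure (Λ → W)).real univ * (f η - f η')| ≤
      (c Λ η : Measure (Λ → W)).real univ * b x +
        (rateDependence c Λ x).toReal * ∑ y ∈ Λ, b y := by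
  have h_integrable (ξ ξ' : S → W) :
      Integrable (fun ζ : Λ → W => f (modify ξ ζ)) (c Λ ξ' : Measure (Λ → W)) :=
    (f.continuous.comp (continuous_modify ξ)).integrable_of_hasCompactSupport
      (.of_compactSpace _)
  let increment (ζ : Λ → W) : ℝ := f (modify η' ζ) - f η'
  have h_increment (ζ : Λ → W) : |increment ζ| ≤ ∑ y ∈ Λ, b y :=
    hf.abs_sub_le_sum Λ fun y hy => modify_of_notMem hy η' ζ
  have h_measurable : StronglyMeasurable increment :=
    ((f.continuous.comp (continuous_modify η')).sub continuous_const).stronglyMeasurable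
  have h_split : jump c Λ f η - jump c Λ f η' +
      (c Λ η : Measure (Λ → W)).real univ * (f η - f η') =
      ∫ ζ, (f (modify η ζ) - f (modify η' ζ)) ∂(c Λ η : Measure (Λ → W)) +
      (∫ ζ, increment ζ ∂(c Λ η : Measure (Λ → W)) -
        ∫ ζ, increment ζ ∂(c Λ η' : Measure (Λ → W))) := by
    simp only [jump_apply_eq_integral_sub, increment]
    rw [integral_sub (h_integrable η η) (h_integrable η' η),
      integral_sub (h_integrable η' η) (integrable_const _),
      integral_sub (h_integrable η' η') (integrable_const _), integral_const, integral_const,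
      smul_eq_mul, smul_eq_mul]
    ring
  rw [h_split]
  refine (abs_add_le _ _).trans (add_le_add ?_ ?_)
  · rw [mul_comm]
    exact norm_integral_le_of_norm_le_const (f := fun ζ => f (modify η ζ) - f (modify η' ζ))
      (.of_forall (hf.abs_modify_sub_modify_le h))
  · refine (abs_integral_sub_integral_le h_measurable h_increment).trans ?_
    rw [mul_comm]
    exact mul_le_mul_of_nonneg_right
      (ENNReal.toReal_mono (rateDependence_ne_top c Λ x) (totalVariation_le_rateDependence c Λ h))
      (Finset.sum_nonneg fun y _ => hb y)

end JumpOperator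

section Superharmonic

/-- The bounds `b` on the variations of a function that the dynamics with rates `c` increases by
at most a factor `e^{κ t}` in time `t`: those satisfying `∑_Λ c_Λ(x) ∑_{y ∈ Λ} b(y) ≤ κ b(x)`.
The sum over `Λ` is encoded by its finite partial sums. -/
structure IsSuperharmonic (c : Rates W S) (κ : ℝ≥0) (b : S → ℝ) : Prop where
  nonneg : ∀ x, 0 ≤ b x
  sum_le : ∀ (F : Finset (Finset S)) (x : S),
    ∑ Λ ∈ F, (rateDependence c Λ x).toReal * ∑ y ∈ Λ, b y ≤ κ * b x

variable {c : Rates W S} {κ : ℝ≥0}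

theorem IsSuperharmonic.const_mul {b : S → ℝ} (hb : IsSuperharmonic c κ b) {r : ℝ} (hr : 0 ≤ r) :
    IsSuperharmonic c κ fun x => r * b x where
  nonneg x := mul_nonneg hr (hb.nonneg x)
  sum_le F x := by
    simp only [← Finset.mul_sum, mul_left_comm _ r]
    exact mul_le_mul_of_nonneg_left (hb.sum_le F x) hr

theorem isSuperharmonic_toReal {b : S → ℝ≥0∞} (hb : ∀ x, b x ≠ ⊤)
    (h : ∀ x, ∑' Λ : Finset S, rateDependence c Λ x * ∑ y ∈ Λ, b y ≤ κ * b x) :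
    IsSuperharmonic c κ fun x => (b x).toReal where
  nonneg _ := ENNReal.toReal_nonneg
  sum_le F x := by
    have h_term (Λ : Finset S) : rateDependence c Λ x * ∑ y ∈ Λ, b y ≠ ⊤ :=
      ENNReal.mul_ne_top (rateDependence_ne_top c Λ x) (ENNReal.sum_ne_top.2 fun y _ => hb y)
    calc ∑ Λ ∈ F, (rateDependence c Λ x).toReal * ∑ y ∈ Λ, (b y).toReal
        = (∑ Λ ∈ F, rateDependence c Λ x * ∑ y ∈ Λ, b y).toReal := by
          rw [ENNReal.toReal_sum fun Λ _ => h_term Λ]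
          refine Finset.sum_congr rfl fun Λ _ => ?_
          rw [ENNReal.toReal_mul, ENNReal.toReal_sum fun y _ => hb y]
      _ ≤ (κ * b x).toReal := ENNReal.toReal_mono (ENNReal.mul_ne_top ENNReal.coe_ne_top (hb x))
          ((ENNReal.sum_le_tsum F).trans (h x))
      _ = κ * (b x).toReal := by rw [ENNReal.toReal_mul, ENNReal.coe_toReal]

/-- The influence `∑_{Λ ∋ y} c_Λ(x)` of the site `x` on the rates of change at the site `y`. -/
noncomputable def influence (c : Rates W S) (x y : S) : ℝ≥0∞ :=
  ∑' Λ : {Λ : Finset S // y ∈ Λ}, rateDependence c Λ x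

theorem kernelApply_influence (b : S → ℝ≥0∞) (x : S) :
    kernelApply (influence c) b x = ∑' Λ : Finset S, rateDependence c Λ x * ∑ y ∈ Λ, b y :=
  (tsum_mul_sum_eq (fun Λ => rateDependence c Λ x) b).symm

variable {R M : ℝ≥0}

theorem tsum_influence_le (hR : ∀ x, ∑' Λ : {Λ : Finset S // x ∈ Λ}, maxRate c Λ ≤ R)
    (hM : ∀ x, ∑' Λ : {Λ : Finset S // x ∈ Λ}, ∑' u : {u : S // u ≠ x}, rateDependence c Λ u ≤ M)
    (y : S) : ∑' x, influence c x y ≤ 2 * R + M := by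
  have h_site (Λ : Finset S) : ∑' x, rateDependence c Λ x ≤
      2 * maxRate c Λ + ∑' u : {u : S // u ≠ y}, rateDependence c Λ u := by
    rw [tsum_eq_add_tsum_ne _ y]
    gcongr
    exact rateDependence_le c Λ y
  calc ∑' x, influence c x y
      = ∑' Λ : {Λ : Finset S // y ∈ Λ}, ∑' x, rateDependence c Λ x := ENNReal.tsum_comm
    _ ≤ ∑' Λ : {Λ : Finset S // y ∈ Λ},
          (2 * maxRate c Λ + ∑' u : {u : S // u ≠ y}, rateDependence c Λ u) :=
        ENNReal.tsum_le_tsum fun Λ => h_site Λ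
    _ ≤ 2 * R + M := by
        rw [ENNReal.tsum_add, ENNReal.tsum_mul_left]
        gcongr
        exacts [hR y, hM y]

theorem exists_isSuperharmonic_isVariationBound
    (hR : ∀ x, ∑' Λ : {Λ : Finset S // x ∈ Λ}, maxRate c Λ ≤ R)
    (hM : ∀ x, ∑' Λ : {Λ : Finset S // x ∈ Λ}, ∑' u : {u : S // u ≠ x}, rateDependence c Λ u ≤ M)
    {f : C(S → W, ℝ)} (hf : tripleNorm f ≠ ⊤) :
    ∃ b : S → ℝ, IsSuperharmonic c (2 * (2 * R + M) + 1) b ∧ IsVariationBound f b ∧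
      ∑' x, ENNReal.ofReal (b x) ≤ 2 * tripleNorm f := by
  obtain ⟨b, h_le, h_sum, h_kernel⟩ :=
    exists_le_kernelApply_le (by finiteness) (tsum_influence_le hR hM) (variation f)
  have hb (x : S) : b x ≠ ⊤ :=
    ne_top_of_le_ne_top (ENNReal.mul_ne_top (by simp) hf) ((ENNReal.le_tsum x).trans h_sum)
  refine ⟨fun x => (b x).toReal, isSuperharmonic_toReal hb fun x => ?_, fun x η ζ h => ?_, ?_⟩
  · rw [← kernelApply_influence]
    exact_mod_cast h_kernel x
  · exact (ENNReal.ofReal_le_iff_le_toReal (hb x)).1 ((le_variation f h).trans (h_le x))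
  · rwa [tsum_congr fun x => ENNReal.ofReal_toReal (hb x)]

end Superharmonic

section FiniteDynamics

variable (c : Rates W S) (F : Finset (Finset S))

/-- A bound for the total jump rate of the dynamics restricted to the sets `Λ ∈ F`, with the
summand `1` making it positive. -/
noncomputable def totalRate : ℝ≥0 := 1 + ∑ Λ ∈ F, rate c Λ

theorem totalRate_pos : (0 : ℝ) < totalRate c F := by
  rw [totalRate]
  positivity

theorem sum_rate_le_totalRate : ∑ Λ ∈ F, (rate c Λ : ℝ) ≤ totalRate c F := by
  rw [totalRate]
  push_cast
  linarith

/-- The transition operator of the discrete skeleton of the dynamics restricted to the sets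
`Λ ∈ F`. -/
noncomputable def finiteStep : C(S → W, ℝ) →L[ℝ] C(S → W, ℝ) :=
  ContinuousLinearMap.id ℝ _ + (totalRate c F : ℝ)⁻¹ • ∑ Λ ∈ F, jump c Λ

theorem finiteStep_apply (f : C(S → W, ℝ)) :
    finiteStep c F f = f + (totalRate c F : ℝ)⁻¹ • ∑ Λ ∈ F, jump c Λ f := by
  simp [finiteStep]

theorem finiteStep_apply_apply (f : C(S → W, ℝ)) (η : S → W) :
    finiteStep c F f η = f η + (totalRate c F : ℝ)⁻¹ * ∑ Λ ∈ F, jump c Λ f η := by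
  rw [finiteStep_apply, ContinuousMap.add_apply, ContinuousMap.smul_apply, smul_eq_mul,
    ContinuousMap.sum_apply]

theorem finiteStep_nonneg (f : C(S → W, ℝ)) (hf : 0 ≤ f) : 0 ≤ finiteStep c F f := fun η => by
  have h_jumps : -(totalRate c F * f η) ≤ ∑ Λ ∈ F, jump c Λ f η := by
    calc -(totalRate c F * f η) ≤ -((∑ Λ ∈ F, (rate c Λ : ℝ)) * f η) :=
          neg_le_neg (mul_le_mul_of_nonneg_right (sum_rate_le_totalRate c F) (hf η))
      _ = ∑ Λ ∈ F, -(rate c Λ * f η) := by rw [Finset.sum_mul, Finset.sum_neg_distrib]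
      _ ≤ _ := Finset.sum_le_sum fun Λ _ => neg_le_jump c Λ hf η
  have h_scaled := mul_le_mul_of_nonneg_left h_jumps (inv_nonneg.2 (totalRate c F).coe_nonneg)
  rw [mul_neg, inv_mul_cancel_left₀ (totalRate_pos c F).ne'] at h_scaled
  change 0 ≤ finiteStep c F f η
  rw [finiteStep_apply_apply]
  linarith

theorem finiteStep_one : finiteStep c F 1 = 1 := by
  simp [finiteStep_apply, jump_one]

/-- The semigroup of the dynamics restricted to the sets `Λ ∈ F`. -/
noncomputable def finiteSemigroup : MarkovSemigroup (S → W) :=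
  .ofPositive (finiteStep c F) (finiteStep_nonneg c F) (finiteStep_one c F) (totalRate c F)

theorem hasGenerator_finiteSemigroup (f : C(S → W, ℝ)) :
    (finiteSemigroup c F).HasGenerator f (∑ Λ ∈ F, jump c Λ f) := by
  have h_step := MarkovSemigroup.hasGenerator_ofPositive (finiteStep c F) (finiteStep_nonneg c F)
    (finiteStep_one c F) (totalRate c F) f
  rwa [finiteStep_apply, add_sub_cancel_left, smul_smul,
    mul_inv_cancel₀ (totalRate_pos c F).ne', one_smul] at h_step

variable {c} {f : C(S → W, ℝ)} {b : S → ℝ} {κ : ℝ≥0}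

theorem abs_sum_jump_sub_add_le (hf : IsVariationBound f b) (hb : IsSuperharmonic c κ b) {x : S}
    {η η' : S → W} (h : ∀ y, y ≠ x → η y = η' y) :
    |∑ Λ ∈ F, jump c Λ f η - ∑ Λ ∈ F, jump c Λ f η' +
        (∑ Λ ∈ F, (c Λ η : Measure (Λ → W)).real univ) * (f η - f η')| ≤
      (∑ Λ ∈ F, (c Λ η : Measure (Λ → W)).real univ) * b x + κ * b x := by
  rw [Finset.sum_mul, ← Finset.sum_sub_distrib, ← Finset.sum_add_distrib]
  calc _ ≤ ∑ Λ ∈ F, ((c Λ η : Measure (Λ → W)).real univ * b x +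
          (rateDependence c Λ x).toReal * ∑ y ∈ Λ, b y) :=
        (Finset.abs_sum_le_sum_abs _ _).trans <|
          Finset.sum_le_sum fun Λ _ => abs_jump_sub_jump_add_le c Λ hf hb.nonneg h
    _ ≤ _ := by
        rw [Finset.sum_add_distrib, Finset.sum_mul]
        exact add_le_add le_rfl (hb.sum_le F x)

theorem IsVariationBound.finiteStep (hf : IsVariationBound f b) (hb : IsSuperharmonic c κ b) :
    IsVariationBound (finiteStep c F f) fun x => (1 + κ / totalRate c F) * b x := by
  intro x η η' h
  have h_rate : ∑ Λ ∈ F, (c Λ η : Measure (Λ → W)).real univ ≤ totalRate c F :=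
    (Finset.sum_le_sum fun Λ _ => measureReal_le_rate c Λ η).trans (sum_rate_le_totalRate c F)
  have h_jumps := abs_sum_jump_sub_add_le F hf hb h
  have hm := totalRate_pos c F
  rw [finiteStep_apply_apply, finiteStep_apply_apply]
  generalize (totalRate c F : ℝ) = m at h_rate hm ⊢
  generalize ∑ Λ ∈ F, (c Λ η : Measure (Λ → W)).real univ = μ at h_rate h_jumps
  generalize ∑ Λ ∈ F, jump c Λ f η = J at h_jumps ⊢
  generalize ∑ Λ ∈ F, jump c Λ f η' = J' at h_jumps ⊢
  have h_stay : |(m - μ) * (f η - f η')| ≤ (m - μ) * b x := by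
    rw [abs_mul, abs_of_nonneg (sub_nonneg.2 h_rate)]
    exact mul_le_mul_of_nonneg_left (hf x η η' h) (sub_nonneg.2 h_rate)
  calc |f η + m⁻¹ * J - (f η' + m⁻¹ * J')|
      = m⁻¹ * |(m - μ) * (f η - f η') + (J - J' + μ * (f η - f η'))| := by
        rw [← abs_of_pos (inv_pos.2 hm), ← abs_mul, abs_of_pos (inv_pos.2 hm)]
        congr 1
        field_simp
        ring
    _ ≤ m⁻¹ * ((m - μ) * b x + (μ * b x + κ * b x)) := by
        gcongr
        exact (abs_add_le _ _).trans (add_le_add h_stay h_jumps)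
    _ = (1 + κ / m) * b x := by
        field_simp
        ring

theorem IsVariationBound.finiteStep_pow (hf : IsVariationBound f b) (hb : IsSuperharmonic c κ b)
    (n : ℕ) :
    IsVariationBound ((IPS.finiteStep c F ^ n) f) fun x => (1 + κ / totalRate c F) ^ n * b x := by
  induction n with
  | zero => simpa using hf
  | succ n ih =>
    simp only [pow_succ', mul_assoc]
    exact ih.finiteStep F (hb.const_mul (by positivity))

theorem IsVariationBound.finiteSemigroup (hf : IsVariationBound f b)
    (hb : IsSuperharmonic c κ b) (t : ℝ≥0) :
    IsVariationBound ((finiteSemigroup c F).op t f) fun x => Real.exp (κ * t) * b x := by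
  intro x η ζ h
  have h_poisson := abs_uniformization_le (IPS.finiteStep c F) (a := t * totalRate c F)
    (by positivity) (ContinuousMap.evalCLM ℝ η - ContinuousMap.evalCLM ℝ ζ) f
    fun n => hf.finiteStep_pow F hb n x η ζ h
  have hm := totalRate_pos c F
  rwa [show (t : ℝ) * totalRate c F * (1 + κ / totalRate c F - 1) = κ * t by field_simp; ring]
    at h_poisson

end FiniteDynamics

section JumpSum

variable {c : Rates W S} {R : ℝ≥0}

theorem tsum_ofReal_rate_mul_sum_le
    (hR : ∀ x, ∑' Λ : {Λ : Finset S // x ∈ Λ}, maxRate c Λ ≤ R) {b : S → ℝ} (hb : ∀ x, 0 ≤ b x) :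
    ∑' Λ : Finset S, ENNReal.ofReal (rate c Λ * ∑ y ∈ Λ, b y) ≤
      R * ∑' x, ENNReal.ofReal (b x) := by
  refine (tsum_congr fun Λ => ?_).trans_le (tsum_mul_sum_le hR fun x => ENNReal.ofReal (b x))
  rw [ENNReal.ofReal_mul (rate c Λ).coe_nonneg, ENNReal.ofReal_coe_nnreal, coe_rate,
    ENNReal.ofReal_sum_of_nonneg fun y _ => hb y]

theorem rate_mul_sum_nonneg {b : S → ℝ} (hb : ∀ x, 0 ≤ b x) (Λ : Finset S) :
    0 ≤ rate c Λ * ∑ y ∈ Λ, b y :=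
  mul_nonneg (rate c Λ).coe_nonneg (Finset.sum_nonneg fun y _ => hb y)

theorem summable_rate_mul_sum
    (hR : ∀ x, ∑' Λ : {Λ : Finset S // x ∈ Λ}, maxRate c Λ ≤ R) {b : S → ℝ} (hb : ∀ x, 0 ≤ b x)
    (hb' : ∑' x, ENNReal.ofReal (b x) ≠ ⊤) :
    Summable fun Λ : Finset S => rate c Λ * ∑ y ∈ Λ, b y := by
  have h_finite : ∑' Λ : Finset S, ENNReal.ofReal (rate c Λ * ∑ y ∈ Λ, b y) ≠ ⊤ :=
    ne_top_of_le_ne_top (ENNReal.mul_ne_top ENNReal.coe_ne_top hb')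
      (tsum_ofReal_rate_mul_sum_le hR hb)
  exact (ENNReal.summable_toReal h_finite).congr fun Λ =>
    ENNReal.toReal_ofReal (rate_mul_sum_nonneg hb Λ)

variable (c) in
/-- `∑_Λ ∫ c_Λ(·, dζ) [f(·^ζ) - f(·)]`, as a series in `C(E)`. -/
noncomputable def jumpSum (f : C(S → W, ℝ)) : C(S → W, ℝ) := ∑' Λ, jump c Λ f

variable {f : C(S → W, ℝ)}

theorem summable_rate_mul_sum_variation
    (hR : ∀ x, ∑' Λ : {Λ : Finset S // x ∈ Λ}, maxRate c Λ ≤ R) (hf : tripleNorm f ≠ ⊤) :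
    Summable fun Λ : Finset S => rate c Λ * ∑ y ∈ Λ, (variation f y).toReal :=
  summable_rate_mul_sum hR (fun _ => ENNReal.toReal_nonneg) (by rwa [tsum_ofReal_variation])

theorem norm_jump_le_variation (Λ : Finset S) :
    ‖jump c Λ f‖ ≤ rate c Λ * ∑ y ∈ Λ, (variation f y).toReal :=
  norm_jump_le c Λ (isVariationBound_variation f) fun _ => ENNReal.toReal_nonneg

theorem hasSum_jump (hR : ∀ x, ∑' Λ : {Λ : Finset S // x ∈ Λ}, maxRate c Λ ≤ R)
    (hf : tripleNorm f ≠ ⊤) : HasSum (fun Λ => jump c Λ f) (jumpSum c f) :=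
  (Summable.of_norm_bounded (summable_rate_mul_sum_variation hR hf)
    fun Λ => norm_jump_le_variation Λ).hasSum

theorem norm_jumpSum_le (hR : ∀ x, ∑' Λ : {Λ : Finset S // x ∈ Λ}, maxRate c Λ ≤ R)
    (hf : tripleNorm f ≠ ⊤) : ‖jumpSum c f‖ ≤ R * (tripleNorm f).toReal := by
  have h_summable := summable_rate_mul_sum_variation hR hf
  have h_norm : ‖jumpSum c f‖ ≤ ∑' Λ : Finset S, rate c Λ * ∑ y ∈ Λ, (variation f y).toReal :=
    tsum_of_norm_bounded h_summable.hasSum fun Λ => norm_jump_le_variation Λ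
  have h_total := tsum_ofReal_rate_mul_sum_le hR (b := fun x => (variation f x).toReal)
    fun _ => ENNReal.toReal_nonneg
  rw [tsum_ofReal_variation, ← ENNReal.ofReal_tsum_of_nonneg
    (rate_mul_sum_nonneg fun _ => ENNReal.toReal_nonneg) h_summable] at h_total
  rw [← ENNReal.coe_toReal, ← ENNReal.toReal_mul]
  exact h_norm.trans ((ENNReal.ofReal_le_iff_le_toReal
    (ENNReal.mul_ne_top ENNReal.coe_ne_top hf)).1 h_total)

end JumpSum

section LimitDynamics

variable {c : Rates W S} {F F' F₀ : Finset (Finset S)} {f : C(S → W, ℝ)} {b : S → ℝ} {κ R M : ℝ≥0}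
  {δ : ℝ}

theorem norm_sum_jump_le {r : ℝ} (hr : 0 ≤ r) (hb : ∀ x, 0 ≤ b x)
    (hf : IsVariationBound f fun x => r * b x) (F : Finset (Finset S)) :
    ‖∑ Λ ∈ F, jump c Λ f‖ ≤ r * ∑ Λ ∈ F, rate c Λ * ∑ y ∈ Λ, b y := by
  calc ‖∑ Λ ∈ F, jump c Λ f‖ ≤ ∑ Λ ∈ F, rate c Λ * ∑ y ∈ Λ, r * b y :=
        norm_sum_le_of_le _ fun Λ _ => norm_jump_le c Λ hf fun x => mul_nonneg hr (hb x)
    _ = r * ∑ Λ ∈ F, rate c Λ * ∑ y ∈ Λ, b y := by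
        simp only [← Finset.mul_sum, mul_left_comm _ r]

theorem norm_sum_jump_sub_sum_jump_le {r : ℝ} (hr : 0 ≤ r) (hb : ∀ x, 0 ≤ b x)
    (hf : IsVariationBound f fun x => r * b x) (hF : F₀ ⊆ F) (hF' : F₀ ⊆ F')
    (hδ : ∀ G, Disjoint G F₀ → ∑ Λ ∈ G, rate c Λ * ∑ y ∈ Λ, b y ≤ δ) :
    ‖∑ Λ ∈ F', jump c Λ f - ∑ Λ ∈ F, jump c Λ f‖ ≤ r * (2 * δ) := by
  classical
  have h_disjoint {G : Finset (Finset S)} (hG : Disjoint G F₀) :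
      ‖∑ Λ ∈ G, jump c Λ f‖ ≤ r * δ :=
    (norm_sum_jump_le hr hb hf G).trans (mul_le_mul_of_nonneg_left (hδ G hG) hr)
  rw [← Finset.sum_sdiff_sub_sum_sdiff]
  calc _ ≤ r * δ + r * δ := (norm_sub_le _ _).trans <|
        add_le_add (h_disjoint (Finset.sdiff_disjoint.mono_right hF))
          (h_disjoint (Finset.sdiff_disjoint.mono_right hF'))
    _ = r * (2 * δ) := by ring

theorem norm_finiteSemigroup_op_sub_op_le (hf : IsVariationBound f b)
    (hb : IsSuperharmonic c κ b) (hF : F₀ ⊆ F) (hF' : F₀ ⊆ F')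
    (hδ : ∀ G, Disjoint G F₀ → ∑ Λ ∈ G, rate c Λ * ∑ y ∈ Λ, b y ≤ δ) (t : ℝ≥0) :
    ‖(finiteSemigroup c F').op t f - (finiteSemigroup c F).op t f‖ ≤
      Real.exp (κ * t) * (2 * δ) * t := by
  refine MarkovSemigroup.norm_op_sub_op_le fun s hs => ⟨_, _, hasGenerator_finiteSemigroup c F _,
    hasGenerator_finiteSemigroup c F' _, ?_⟩
  refine norm_sum_jump_sub_sum_jump_le (Real.exp_pos _).le hb.nonneg ?_ hF hF' hδ
  refine (hf.finiteSemigroup F' hb s).mono fun x => ?_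
  have hbx := hb.nonneg x
  gcongr

theorem uniformCauchySeqOn_finiteSemigroup
    (hR : ∀ x, ∑' Λ : {Λ : Finset S // x ∈ Λ}, maxRate c Λ ≤ R) (hf : IsVariationBound f b)
    (hb : IsSuperharmonic c κ b) (hb' : ∑' x, ENNReal.ofReal (b x) ≠ ⊤) (t₀ : ℝ≥0) :
    UniformCauchySeqOn (fun F t => (finiteSemigroup c F).op t f) atTop (Iic t₀) := by
  intro V hV
  obtain ⟨ε, hε, hεV⟩ := Metric.mem_uniformity_dist.1 hV
  have hδ : 0 < ε / (2 * Real.exp (κ * t₀) * (t₀ + 1)) := by positivity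
  obtain ⟨F₀, hF₀⟩ := summable_iff_vanishing_norm.1 (summable_rate_mul_sum hR hb.nonneg hb') _ hδ
  have h_tail (G : Finset (Finset S)) (hG : Disjoint G F₀) := (le_abs_self _).trans (hF₀ G hG).le
  have h_eventually : ∀ᶠ F : Finset (Finset S) in atTop, F₀ ⊆ F := eventually_ge_atTop F₀
  filter_upwards [h_eventually.prod_mk h_eventually] with p hp t ht
  refine hεV ?_
  rw [dist_eq_norm]
  have ht' : (t : ℝ) ≤ t₀ := ht
  calc _ ≤ Real.exp (κ * t) * (2 * (ε / (2 * Real.exp (κ * t₀) * (t₀ + 1)))) * t :=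
        norm_finiteSemigroup_op_sub_op_le hf hb hp.2 hp.1 h_tail t
    _ ≤ Real.exp (κ * t₀) * (2 * (ε / (2 * Real.exp (κ * t₀) * (t₀ + 1)))) * t₀ := by gcongr
    _ < Real.exp (κ * t₀) * (2 * (ε / (2 * Real.exp (κ * t₀) * (t₀ + 1)))) * (t₀ + 1) := by
        gcongr
        exact lt_add_one _
    _ = ε := by field_simp

/-- The semigroup `T` preserves the space `D`, with summable bounds for the variations that grow
at most like `e^{κ t}`: these bounds serve as majorants for the continuity in `t`. -/
def HasVariationGrowth {W S : Type*} [TopologicalSpace W] [CompactSpace W]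
    (T : MarkovSemigroup (S → W)) (κ : ℝ≥0) : Prop :=
  ∀ f : TestSpace W S, ∃ b : S → ℝ,
    ∑' x, ENNReal.ofReal (b x) ≤ 2 * tripleNorm (TestSpace.incl W S f) ∧
    ∀ t, IsVariationBound (T.op t (TestSpace.incl W S f)) fun x => Real.exp (κ * t) * b x

theorem exists_semigroup [Countable S]
    (hR : ∀ x, ∑' Λ : {Λ : Finset S // x ∈ Λ}, maxRate c Λ ≤ R)
    (hM : ∀ x, ∑' Λ : {Λ : Finset S // x ∈ Λ}, ∑' u : {u : S // u ≠ x}, rateDependence c Λ u ≤ M) :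
    ∃ T : MarkovSemigroup (S → W),
      (∀ f : TestSpace W S,
        T.HasGenerator (TestSpace.incl W S f) (jumpSum c (TestSpace.incl W S f))) ∧
      HasVariationGrowth T (2 * (2 * R + M) + 1) := by
  have h_bound (f : TestSpace W S) :=
    exists_isSuperharmonic_isVariationBound hR hM (TestSpace.tripleNorm_lt_top f).ne
  obtain ⟨T, hT⟩ := MarkovSemigroup.exists_tendsto_of_uniformCauchySeqOn
    (U := finiteSemigroup c) (l := atTop) (denseRange_incl (W := W) (S := S)) <| by
      rintro _ ⟨f, rfl⟩ t₀
      obtain ⟨b, hb, hfb, hb'⟩ := h_bound f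
      exact uniformCauchySeqOn_finiteSemigroup hR hfb hb (ne_top_of_le_ne_top
        (ENNReal.mul_ne_top (by simp) (TestSpace.tripleNorm_lt_top f).ne) hb') t₀
  refine ⟨T, fun f => ?_, fun f => ?_⟩
  · exact MarkovSemigroup.HasGenerator.of_tendsto (fun F => hasGenerator_finiteSemigroup c F _)
      tendsto_const_nhds (hasSum_jump hR (TestSpace.tripleNorm_lt_top f).ne) hT
  · obtain ⟨b, hb, hfb, hb'⟩ := h_bound f
    exact ⟨b, hb', fun t => .of_tendsto (hT t _) fun F => hfb.finiteSemigroup F hb t⟩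

end LimitDynamics

end IPS

theorem norm_expFun_le {E : Type*} [TopologicalSpace E] [CompactSpace E] (f : C(E, ℝ)) :
    ‖expFun f‖ ≤ Real.exp ‖f‖ :=
  (ContinuousMap.norm_le _ (Real.exp_pos _).le).2 fun x => by
    change ‖Real.exp (f x)‖ ≤ _
    rw [Real.norm_of_nonneg (Real.exp_pos _).le]
    exact Real.exp_le_exp.2 ((le_abs_self _).trans (f.norm_coe_le_norm x))

namespace IPS

section Semigroup

variable {W S : Type*} [TopologicalSpace W] [CompactSpace W] {T : MarkovSemigroup (S → W)}
  {κ : ℝ≥0}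

theorem HasVariationGrowth.tripleNorm_op_le (h : HasVariationGrowth T κ) (t : ℝ≥0)
    (f : TestSpace W S) : tripleNorm (T.op t (TestSpace.incl W S f)) ≤
      ENNReal.ofReal (Real.exp (κ * t)) * (2 * tripleNorm (TestSpace.incl W S f)) := by
  obtain ⟨b, hb, hfb⟩ := h f
  calc tripleNorm (T.op t (TestSpace.incl W S f))
      ≤ ∑' x, ENNReal.ofReal (Real.exp (κ * t) * b x) := (hfb t).tripleNorm_le
    _ = ENNReal.ofReal (Real.exp (κ * t)) * ∑' x, ENNReal.ofReal (b x) := by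
        simp_rw [ENNReal.ofReal_mul (Real.exp_pos _).le, ENNReal.tsum_mul_left]
    _ ≤ _ := by gcongr

namespace TestSpace

theorem ofReal_mul_tripleNorm_lt_top (r : ℝ) (f : TestSpace W S) :
    ENNReal.ofReal r * (2 * tripleNorm (incl W S f)) < ⊤ :=
  ENNReal.mul_lt_top ENNReal.ofReal_lt_top (ENNReal.mul_lt_top (by simp) (tripleNorm_lt_top f))

theorem toReal_tripleNorm_op_le (h : HasVariationGrowth T κ) (t : ℝ≥0) (f : TestSpace W S) :
    (tripleNorm (T.op t (incl W S f))).toReal ≤ Real.exp (κ * t) * (2 * ‖f‖) := by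
  have h_toReal := ENNReal.toReal_mono (ofReal_mul_tripleNorm_lt_top _ f).ne
    (h.tripleNorm_op_le t f)
  rw [ENNReal.toReal_mul, ENNReal.toReal_mul, ENNReal.toReal_ofReal (Real.exp_pos _).le,
    ENNReal.toReal_ofNat] at h_toReal
  exact h_toReal.trans (by gcongr; exact toReal_tripleNorm_le f)

/-- The operator `S(t)` of the semigroup on the space `D`. -/
noncomputable def semigroup (h : HasVariationGrowth T κ) (t : ℝ≥0) :
    TestSpace W S →L[ℝ] TestSpace W S :=
  LinearMap.mkContinuous
    { toFun := fun f => ofFinite (T.op t (incl W S f))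
        ((h.tripleNorm_op_le t f).trans_lt (ofReal_mul_tripleNorm_lt_top _ f))
      map_add' := fun f g => incl_injective (by simp)
      map_smul' := fun a f => incl_injective (by simp) }
    (Real.exp (κ * t) * 2 + 1) fun f => by
      have h_triple := toReal_tripleNorm_op_le h t f
      have h_sup := (T.norm_op_le t (incl W S f)).trans (norm_incl_le f)
      change (tripleNorm (T.op t (incl W S f))).toReal + ‖T.op t (incl W S f)‖ ≤ _
      linarith

@[simp] theorem incl_semigroup (h : HasVariationGrowth T κ) (t : ℝ≥0) (f : TestSpace W S) :
    incl W S (semigroup h t f) = T.op t (incl W S f) := rfl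

theorem continuous_semigroup_apply (h : HasVariationGrowth T κ) (f : TestSpace W S) :
    Continuous fun t => semigroup h t f := by
  refine continuous_iff_continuousAt.2 fun t₀ => ?_
  obtain ⟨b, hb, hfb⟩ := h f
  refine tendsto_of_dominated
    (a := fun x => ENNReal.ofReal (Real.exp (κ * (t₀ + 1))) * ENNReal.ofReal (b x))
    (b := fun _ _ => 0) ((T.continuous_op (incl W S f)).tendsto t₀) ?_ ?_ (by simp)
  · filter_upwards [Iic_mem_nhds (lt_add_one t₀)] with t ht x
    have ht' : (t : ℝ) ≤ t₀ + 1 := by exact_mod_cast ht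
    rw [add_zero, incl_semigroup]
    refine ((hfb t).variation_le x).trans ?_
    rw [ENNReal.ofReal_mul (Real.exp_pos _).le]
    gcongr
  · rw [ENNReal.tsum_mul_left]
    exact ((mul_le_mul_right hb _).trans_lt (ofReal_mul_tripleNorm_lt_top _ f)).ne

/-- The nonlinear operator `V(t) f = log S(t) e^f` on the space `D`. -/
noncomputable def logSemigroup (h : HasVariationGrowth T κ) (t : ℝ≥0) (f : TestSpace W S) :
    TestSpace W S :=
  lipschitzComp Real.log (semigroup h t (exp f)) <|
    (exists_lipschitzOnWith_log (Real.exp_pos (-‖incl W S f‖)) (Real.exp ‖incl W S f‖)).imp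
      fun _ hL => hL.mono <| range_subset_iff.2 <| T.op_expFun_mem_Icc t le_rfl

theorem continuous_logSemigroup (h : HasVariationGrowth T κ) (t : ℝ≥0) :
    Continuous (logSemigroup h t) := by
  refine continuous_iff_continuousAt.2 fun f => ?_
  obtain ⟨L, hL⟩ := exists_lipschitzOnWith_log (Real.exp_pos (-(‖incl W S f‖ + 1)))
    (Real.exp (‖incl W S f‖ + 1))
  exact tendsto_of_lipschitzOnWith hL (((semigroup h t).continuous.comp continuous_exp).tendsto f)
    ((eventually_norm_incl_le f).mono fun g hg => T.op_expFun_mem_Icc t hg)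
    (T.op_expFun_mem_Icc t (lt_add_one _).le) (fun _ _ => rfl) fun _ => rfl

theorem continuous_logSemigroup_apply (h : HasVariationGrowth T κ) (f : TestSpace W S) :
    Continuous fun t => logSemigroup h t f := by
  refine continuous_iff_continuousAt.2 fun t => ?_
  obtain ⟨L, hL⟩ :=
    exists_lipschitzOnWith_log (Real.exp_pos (-‖incl W S f‖)) (Real.exp ‖incl W S f‖)
  exact tendsto_of_lipschitzOnWith hL ((continuous_semigroup_apply h (exp f)).tendsto t)
    (.of_forall fun s => T.op_expFun_mem_Icc s le_rfl) (T.op_expFun_mem_Icc t le_rfl)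
    (fun _ _ => rfl) fun _ => rfl

end TestSpace

end Semigroup

section Generator

variable {W S : Type*} [MetricSpace W] [CompactSpace W] [MeasurableSpace W] [BorelSpace W]
  {c : Rates W S} {R : ℝ≥0}

theorem hasFormalGenerator_jumpSum
    (hR : ∀ x, ∑' Λ : {Λ : Finset S // x ∈ Λ}, maxRate c Λ ≤ R) {f : C(S → W, ℝ)}
    (hf : tripleNorm f ≠ ⊤) : HasFormalGenerator c f (jumpSum c f) := fun η =>
  (hasSum_jump hR hf).mapL (ContinuousMap.evalCLM ℝ η)

theorem mem_graph_formalGenerator {p : C(S → W, ℝ) × C(S → W, ℝ)} :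
    p ∈ (formalGenerator c).graph ↔ p.1 ∈ testFunctions W S ∧ HasFormalGenerator c p.1 p.2 := by
  rw [LinearPMap.mem_graph_iff]
  constructor
  · rintro ⟨f, hf, hg⟩
    rw [← hf, ← hg]
    exact ⟨f.2.1, Classical.choose_spec f.2.2⟩
  · rintro ⟨hf, hg⟩
    exact ⟨⟨p.1, hf, p.2, hg⟩, rfl, (Classical.choose_spec (⟨p.2, hg⟩ : ∃ g, _)).unique hg⟩

theorem domain_formalGenerator
    (hR : ∀ x, ∑' Λ : {Λ : Finset S // x ∈ Λ}, maxRate c Λ ≤ R) :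
    (formalGenerator c).domain = testFunctions W S :=
  le_antisymm (fun _ hf => hf.1) fun _ hf => ⟨hf, _, hasFormalGenerator_jumpSum hR hf.ne⟩

variable {T : MarkovSemigroup (S → W)}

theorem graph_formalGenerator_le
    (hR : ∀ x, ∑' Λ : {Λ : Finset S // x ∈ Λ}, maxRate c Λ ≤ R)
    (hT : ∀ f : TestSpace W S,
      T.HasGenerator (TestSpace.incl W S f) (jumpSum c (TestSpace.incl W S f))) :
    (formalGenerator c).graph ≤ T.generator.graph := by
  rintro ⟨f, g⟩ hfg
  obtain ⟨hf, hg⟩ := mem_graph_formalGenerator.1 hfg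
  obtain rfl : jumpSum c f = g := (hasFormalGenerator_jumpSum hR hf.ne).unique hg
  exact MarkovSemigroup.mem_graph_generator.2 (hT ⟨f, hf⟩)

theorem isClosable_formalGenerator
    (hR : ∀ x, ∑' Λ : {Λ : Finset S // x ∈ Λ}, maxRate c Λ ≤ R)
    (hT : ∀ f : TestSpace W S,
      T.HasGenerator (TestSpace.incl W S f) (jumpSum c (TestSpace.incl W S f))) :
    (formalGenerator c).IsClosable :=
  T.isClosed_generator.isClosable.leIsClosable
    (LinearPMap.le_of_le_graph (graph_formalGenerator_le hR hT))

theorem generator_eq_closure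
    (hR : ∀ x, ∑' Λ : {Λ : Finset S // x ∈ Λ}, maxRate c Λ ≤ R)
    (hT : ∀ f : TestSpace W S,
      T.HasGenerator (TestSpace.incl W S f) (jumpSum c (TestSpace.incl W S f)))
    (h_finite : ∀ t (f : TestSpace W S), tripleNorm (T.op t (TestSpace.incl W S f)) < ⊤) :
    T.generator = (formalGenerator c).closure := by
  refine LinearPMap.eq_of_eq_graph ?_
  rw [← (isClosable_formalGenerator hR hT).graph_closure_eq_closure_graph]
  refine le_antisymm (fun p hp => ?_) (Submodule.topologicalClosure_minimal _
    (graph_formalGenerator_le hR hT) T.isClosed_generator)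
  refine MarkovSemigroup.HasGenerator.mem_of_dense_invariant
    (Submodule.isClosed_topologicalClosure _) denseRange_incl ?_
    (MarkovSemigroup.mem_graph_generator.1 hp)
  rintro _ ⟨f, rfl⟩
  refine ⟨_, hT f, fun t => Submodule.le_topologicalClosure _ ?_⟩
  have h_commute : jumpSum c (T.op t (TestSpace.incl W S f)) = T.op t (jumpSum c _) :=
    (hT (.ofFinite _ (h_finite t f))).unique ((hT f).op t)
  rw [← h_commute]
  exact mem_graph_formalGenerator.2
    ⟨h_finite t f, hasFormalGenerator_jumpSum hR (h_finite t f).ne⟩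

theorem exists_seq_tendsto_generator
    (hR : ∀ x, ∑' Λ : {Λ : Finset S // x ∈ Λ}, maxRate c Λ ≤ R)
    (hT : ∀ f : TestSpace W S,
      T.HasGenerator (TestSpace.incl W S f) (jumpSum c (TestSpace.incl W S f)))
    (h_closure : T.generator = (formalGenerator c).closure) (f : T.generator.domain) :
    ∃ u : ℕ → TestSpace W S,
      Tendsto (fun n => TestSpace.incl W S (u n)) atTop (𝓝 (f : C(S → W, ℝ))) ∧
      Tendsto (fun n => T.generator ⟨TestSpace.incl W S (u n), _, hT (u n)⟩) atTop
        (𝓝 (T.generator f)) := by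
  have h_mem : ((f : C(S → W, ℝ)), T.generator f) ∈
      (formalGenerator c).graph.topologicalClosure := by
    rw [(isClosable_formalGenerator hR hT).graph_closure_eq_closure_graph, ← h_closure]
    exact T.generator.mem_graph f
  obtain ⟨u, hu, h_lim⟩ := mem_closure_iff_seq_limit.1 h_mem
  obtain ⟨h_fst, h_snd⟩ := (Prod.tendsto_iff _ _).1 h_lim
  refine ⟨fun n => .ofFinite (u n).1 (mem_graph_formalGenerator.1 (hu n)).1, h_fst,
    h_snd.congr fun n => ?_⟩
  exact (MarkovSemigroup.HasGenerator.generator_eq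
    (MarkovSemigroup.mem_graph_generator.1 (graph_formalGenerator_le hR hT (hu n))) _).symm

theorem algebraCoreCondition
    (hR : ∀ x, ∑' Λ : {Λ : Finset S // x ∈ Λ}, maxRate c Λ ≤ R)
    (hT : ∀ f : TestSpace W S,
      T.HasGenerator (TestSpace.incl W S f) (jumpSum c (TestSpace.incl W S f)))
    (h_closure : T.generator = (formalGenerator c).closure) :
    AlgebraCoreCondition T (TestSpace.incl W S) where
  injective := TestSpace.incl_injective
  le_domain f := ⟨_, hT f⟩
  core := exists_seq_tendsto_generator hR hT h_closure
  dense := denseRange_incl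
  mul_mem f g := ⟨TestSpace.mulCLM W S f g, rfl⟩
  smooth_comp_mem f φ _ hU hfU hφ :=
    ⟨.lipschitzComp φ f (exists_lipschitzOnWith_of_contDiffOn hU (hφ.of_le (by norm_cast))
      (isCompact_range (TestSpace.incl W S f).continuous) hfU), fun _ => rfl⟩

theorem continuous_generator_incl
    (hR : ∀ x, ∑' Λ : {Λ : Finset S // x ∈ Λ}, maxRate c Λ ≤ R)
    (hT : ∀ f : TestSpace W S,
      T.HasGenerator (TestSpace.incl W S f) (jumpSum c (TestSpace.incl W S f))) :
    Continuous fun f : TestSpace W S => T.generator ⟨TestSpace.incl W S f, _, hT f⟩ := by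
  let A : TestSpace W S →ₗ[ℝ] C(S → W, ℝ) :=
    T.generator.toFun.comp
      ((TestSpace.incl W S).codRestrict T.generator.domain fun f => ⟨_, hT f⟩)
  refine (A.mkContinuous R fun f => ?_).continuous
  have h_apply : A f = jumpSum c (TestSpace.incl W S f) := (hT f).generator_eq _
  rw [h_apply]
  refine (norm_jumpSum_le hR (TestSpace.tripleNorm_lt_top f).ne).trans ?_
  gcongr
  exact TestSpace.toReal_tripleNorm_le f

theorem expFun_incl_mem_domain
    (hT : ∀ f : TestSpace W S,
      T.HasGenerator (TestSpace.incl W S f) (jumpSum c (TestSpace.incl W S f)))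
    (f : TestSpace W S) : expFun (TestSpace.incl W S f) ∈ T.generator.domain :=
  ⟨_, hT (TestSpace.exp f)⟩

theorem norm_hamiltonian_le
    (hR : ∀ x, ∑' Λ : {Λ : Finset S // x ∈ Λ}, maxRate c Λ ≤ R)
    (hT : ∀ f : TestSpace W S,
      T.HasGenerator (TestSpace.incl W S f) (jumpSum c (TestSpace.incl W S f)))
    {f : TestSpace W S} {r : ℝ} (hf : ‖f‖ ≤ r)
    (hd : expFun (TestSpace.incl W S f) ∈ T.generator.domain) :
    ‖hamiltonian T.generator (TestSpace.incl W S f) hd‖ ≤ R * (r * Real.exp (2 * r)) := by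
  have h_sup : ‖TestSpace.incl W S f‖ ≤ r := (TestSpace.norm_incl_le f).trans hf
  have h_exp : ‖expFun (-TestSpace.incl W S f)‖ ≤ Real.exp r :=
    (norm_expFun_le _).trans (Real.exp_le_exp.2 ((norm_neg _).trans_le h_sup))
  have h_triple : (tripleNorm (expFun (TestSpace.incl W S f))).toReal ≤ Real.exp r * r := by
    refine (TestSpace.toReal_tripleNorm_exp_le f).trans ?_
    gcongr
    exact (TestSpace.toReal_tripleNorm_le f).trans hf
  have h_jump : ‖jumpSum c (expFun (TestSpace.incl W S f))‖ ≤ R * (Real.exp r * r) :=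
    (norm_jumpSum_le hR (TestSpace.tripleNorm_lt_top (.exp f)).ne).trans
      (mul_le_mul_of_nonneg_left h_triple R.coe_nonneg)
  have h_generator : T.generator ⟨expFun (TestSpace.incl W S f), hd⟩ =
      jumpSum c (expFun (TestSpace.incl W S f)) := (hT (.exp f)).generator_eq hd
  rw [hamiltonian, h_generator]
  calc _ ≤ ‖expFun (-TestSpace.incl W S f)‖ * ‖jumpSum c (expFun (TestSpace.incl W S f))‖ :=
        norm_mul_le _ _
    _ ≤ Real.exp r * (R * (Real.exp r * r)) := by gcongr
    _ = R * (r * Real.exp (2 * r)) := by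
        rw [two_mul, Real.exp_add]
        ring

theorem exists_isBarrel_hamiltonian_le
    (hR : ∀ x, ∑' Λ : {Λ : Finset S // x ∈ Λ}, maxRate c Λ ≤ R)
    (hT : ∀ f : TestSpace W S,
      T.HasGenerator (TestSpace.incl W S f) (jumpSum c (TestSpace.incl W S f))) :
    ∃ N : Set (TestSpace W S), IsBarrel N ∧
      (∀ f ∈ N, ‖hamiltonian T.generator (TestSpace.incl W S f)
        (expFun_incl_mem_domain hT f)‖ ≤ 1) ∧
      ∀ a : ℝ, 0 < a → ∃ M : ℝ, ∀ f ∈ a • N, ‖hamiltonian T.generator (TestSpace.incl W S f)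
        (expFun_incl_mem_domain hT f)‖ ≤ M := by
  let r : ℝ := (R * Real.exp 2 + 1)⁻¹
  have h_nonneg : 0 ≤ R * Real.exp 2 := by positivity
  have hr : 0 < r := by positivity
  have hr1 : r ≤ 1 := inv_le_one_of_one_le₀ (le_add_of_nonneg_left h_nonneg)
  refine ⟨Metric.closedBall 0 r, .closedBall hr, fun f hf => ?_, fun a ha => ?_⟩
  · calc _ ≤ R * (r * Real.exp (2 * r)) :=
          norm_hamiltonian_le hR hT (mem_closedBall_zero_iff.1 hf) _
      _ ≤ R * (r * Real.exp 2) := by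
          gcongr
          linarith
      _ = R * Real.exp 2 / (R * Real.exp 2 + 1) := by rw [div_eq_mul_inv]; ring
      _ ≤ 1 := div_le_one_of_le₀ (le_add_of_nonneg_right zero_le_one) (by positivity)
  · refine ⟨R * (a * r * Real.exp (2 * (a * r))), ?_⟩
    rintro _ ⟨g, hg, rfl⟩
    refine norm_hamiltonian_le hR hT ?_ _
    change ‖a • g‖ ≤ a * r
    rw [norm_smul, Real.norm_of_nonneg ha.le]
    exact mul_le_mul_of_nonneg_left (mem_closedBall_zero_iff.1 hg) ha.le

theorem topologicalCoreCondition [Countable S]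
    (hR : ∀ x, ∑' Λ : {Λ : Finset S // x ∈ Λ}, maxRate c Λ ≤ R)
    (hT : ∀ f : TestSpace W S,
      T.HasGenerator (TestSpace.incl W S f) (jumpSum c (TestSpace.incl W S f)))
    (h_closure : T.generator = (formalGenerator c).closure) {κ : ℝ≥0}
    (h_growth : HasVariationGrowth T κ) :
    TopologicalCoreCondition T (TestSpace.incl W S) where
  toAlgebraCoreCondition := algebraCoreCondition hR hT h_closure
  isTopologicalAddGroup := inferInstance
  continuousSMul := inferInstance
  locallyConvex := inferInstance
  hausdorff := inferInstance
  separable := inferInstance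
  barrelled _ hB := hB.mem_nhds_zero
  finer := TestSpace.continuous_incl
  exp_sub_one := ⟨fun f => .exp f - .one W S, fun _ => rfl,
    TestSpace.continuous_exp.sub continuous_const⟩
  mul := ⟨fun p => TestSpace.mulCLM W S p.1 p.2, fun _ => rfl,
    (TestSpace.mulCLM W S).continuous₂⟩
  semigroup := ⟨fun t => TestSpace.semigroup h_growth t, fun _ _ => rfl,
    fun t => (TestSpace.semigroup h_growth t).continuous,
    TestSpace.continuous_semigroup_apply h_growth⟩
  log_semigroup := ⟨TestSpace.logSemigroup h_growth, fun _ _ _ => rfl,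
    TestSpace.continuous_logSemigroup h_growth,
    TestSpace.continuous_logSemigroup_apply h_growth⟩
  continuous_generator := continuous_generator_incl hR hT
  exp_mem_domain := expFun_incl_mem_domain hT
  hamiltonian_bound := exists_isBarrel_hamiltonian_le hR hT

end Generator

end IPS

theorem mainTheorem7 {W S : Type*} [MetricSpace W] [CompactSpace W] [MeasurableSpace W]
    [BorelSpace W] [Countable S] (c : IPS.Rates W S)
    (h_rate : (⨆ x : S, ∑' Λ : {Λ : Finset S // x ∈ Λ}, IPS.maxRate c Λ) < ⊤)
    (h_dependence : (⨆ x : S, ∑' Λ : {Λ : Finset S // x ∈ Λ}, ∑' u : {u : S // u ≠ x},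
      IPS.rateDependence c Λ u) < ⊤) :
    CompleteSpace (IPS.TestSpace W S) ∧
    TopologicalSpace.SeparableSpace (IPS.TestSpace W S) ∧
    (IPS.formalGenerator c).domain = IPS.testFunctions W S ∧
    (IPS.formalGenerator c).IsClosable ∧
    (∃ T : MarkovSemigroup (S → W), T.generator = (IPS.formalGenerator c).closure) ∧
    ∀ T : MarkovSemigroup (S → W), T.generator = (IPS.formalGenerator c).closure →
      AlgebraCoreCondition T (IPS.TestSpace.incl W S) ∧
      TopologicalCoreCondition T (IPS.TestSpace.incl W S) := by
  obtain ⟨R, hR, -⟩ := ENNReal.lt_iff_exists_coe.1 h_rate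
  obtain ⟨M, hM, -⟩ := ENNReal.lt_iff_exists_coe.1 h_dependence
  have h_rate_le := iSup_le_iff.1 hR.le
  obtain ⟨T, hT, h_growth⟩ := IPS.exists_semigroup h_rate_le (iSup_le_iff.1 hM.le)
  have h_finite t f := (h_growth.tripleNorm_op_le t f).trans_lt
    (IPS.TestSpace.ofReal_mul_tripleNorm_lt_top _ f)
  have h_closure := IPS.generator_eq_closure h_rate_le hT h_finite
  have h_dense : Dense (T.generator.domain : Set C(S → W, ℝ)) :=
    IPS.denseRange_incl.mono (range_subset_iff.2 fun f => ⟨_, hT f⟩)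
  refine ⟨inferInstance, inferInstance, IPS.domain_formalGenerator h_rate_le,
    IPS.isClosable_formalGenerator h_rate_le hT, ⟨T, h_closure⟩, fun T' hT' => ?_⟩
  obtain rfl : T = T' := MarkovSemigroup.eq_of_generator_eq (h_closure.trans hT'.symm) h_dense
  exact ⟨IPS.algebraCoreCondition h_rate_le hT h_closure,
    IPS.topologicalCoreCondition h_rate_le hT h_closure h_growth⟩
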